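/- Let $\mathcal B$ be a modular category over $\mathbb C$: an abelian semisimple rigid braided $\mathbb C$-linear category with finite-dimensional morphism spaces, finitely many isomorphism classes of simple objects, simple unit, a ribbon twist $\theta$, and invertible $S$-matrix. Let $a$ range over a complete set $\Pi_{\mathcal B}$ of representatives of the simple objects, with $0$ the label of the unit; let $\theta_a$ and $d_a$ be the twist and quantum dimension, $D>0$ with $D^2=\sum_a d_a^2$, $N_{ab}^c=\dim\mathrm{Hom}(c,a\otimes b)$, and $$S_{ab}=\frac1D\,\mathrm{Tr}(c_{\bar b,a}\circ c_{a,\bar b})=\frac1D\sum_c N_{a\bar b}^c\frac{\theta_c}{\theta_a\theta_b}d_c ,$$ where $c_{-,-}$ is the braiding, $\bar b$ the dual of $b$, $\mathrm{Tr}$ the quantum trace, and ${}^*$ on numbers denotes complex conjugation. The matrix $[R^{aa}_c]_{\mu\nu}$ is the matrix, in any basis of $\mathrm{Hom}(c,a\otimes a)$, of composition with the braiding $c_{a,a}$. (1) For all $a,c$, $$\sum_\mu[R^{aa}_c]_{\mu\mu}=\sum_{x,y,z}\frac{\theta_y^2}{\theta_a\theta_x^2}\,\frac{S_{0y}S_{az}S_{xz}^*S_{cx}^*S_{yz}^*}{S_{0z}}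 .$$ For either choice of a square root $\theta_c^{1/2}$, the matrix $\frac{\theta_a}{\theta_c^{1/2}}R^{aa}_c$ squares to the identity, and $$\sum_\mu[R^{aa}_c]_{\mu\mu}=\frac{\theta_c^{1/2}}{\theta_a}\Lambda_{a,c},$$ where $\Lambda_{a,c}\in\mathbb Z$ is its signature: the multiplicity of the eigenvalue $+1$ minus that of $-1$. The number $\theta_c^{1/2}\Lambda_{a,c}$ is determined by the modular data: it equals $\theta_a$ times the triple sum above, and if a bijection between the labels of two modular categories preserves $0$, $S$ and $\theta$, then it carries $\theta_c^{1/2}\Lambda_{a,c}$ to $\theta_c^{1/2}\Lambda_{a,c}$ (and $\Lambda_{a,c}$ to $\Lambda_{a,c}$ if the same square root is used in both). For $c=0$, $\theta_0^{1/2}\Lambda_{a,0}=\kappa_a$ is the (second) Frobenius–Schur indicator of $a$, i.e. the trace of the rotation operator on $\mathrm{Hom}(\mathbf 1,a\otimes a)$ (which is $0$ if $a$ is not self-dual). (2) If $\mathcal B$ is multiplicity-free ($N_{ab}^c\le1$ for all $a,b,c$), then for all $a,c$ with $N_{aa}^c\ne0$ the number $R^{aa}_c$ satisfies $$R^{aa}_c=\sum_{x,y,z}\frac{\theta_y^2}{\theta_a\theta_x^2}\,\frac{S_{0y}S_{az}S_{xz}^*S_{cx}^*S_{yz}^*}{S_{0z}}=\Lambda_{a,c}\,\frac{\theta_c^{1/2}}{\theta_a},\qquad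 \Lambda_{a,c}=\pm1,$$ where, for a given choice of $\theta_c^{1/2}$, the sign $\Lambda_{a,c}$ is determined by the modular data. -/

import Mathlib

open CategoryTheory MonoidalCategory

noncomputable section

namespace ModCat

universe v u w

/-- The scalar `z` by which an endomorphism `f = z • 𝟙` acts.  For a simple object (in particular
for the tensor unit) of a premodular category every endomorphism has this form, and `z` is
unique; the value `0` for other endomorphisms is never used. -/
def scalar {C : Type u} [Category.{v} C] [Preadditive C] [Linear ℂ C] {X : C} (f : X ⟶ X) : ℂ :=
  open Classical in if h : ∃ z : ℂ, f = z • 𝟙 X then h.choose else 0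

/-- A complete set of representatives `(obj a)`, `a : ι`, of the isomorphism classes of simple
objects ("anyon types"), with the label `zero` of the class of the tensor unit. -/
structure SimpleReps (C : Type u) [Category.{v} C] [Preadditive C] [MonoidalCategory C]
    (ι : Type w) where
  obj : ι → C
  simple : ∀ a, Simple (obj a)
  eq_of_iso : ∀ a b, Nonempty (obj a ≅ obj b) → a = b
  exists_iso : ∀ X : C, Simple X → ∃ a, Nonempty (X ≅ obj a)
  zero : ι
  zero_iso : Nonempty (obj zero ≅ 𝟙_ C)

/-- A premodular category over `ℂ`: a braided fusion category (rigid, semisimple, `ℂ`-linear,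
with finite-dimensional morphism spaces, finitely many classes of simple objects and simple tensor
unit) with a ribbon twist `θ`. -/
class PremodularCategory (C : Type u) [Category.{v} C] [Abelian C] [Linear ℂ C]
    [MonoidalCategory C] [MonoidalPreadditive C] [MonoidalLinear ℂ C] [BraidedCategory C]
    [RigidCategory C] where
  finiteDimensional_hom : ∀ X Y : C, FiniteDimensional ℂ (X ⟶ Y)
  simple_unit : Simple (𝟙_ C)
  semisimple : ∀ X : C, ∃ (n : ℕ) (s : Fin n → C) (B : Limits.Bicone s),
    (∀ i, Simple (s i)) ∧ Nonempty B.IsBilimit ∧ Nonempty (X ≅ B.pt)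
  finite_simples : ∃ n : ℕ, Nonempty (SimpleReps C (Fin n))
  twist : ∀ X : C, X ≅ X
  twist_naturality : ∀ {X Y : C} (f : X ⟶ Y), f ≫ (twist Y).hom = (twist X).hom ≫ f
  twist_tensor : ∀ X Y : C, (twist (X ⊗ Y)).hom =
    ((twist X).hom ⊗ₘ (twist Y).hom) ≫ (β_ X Y).hom ≫ (β_ Y X).hom
  twist_dual : ∀ X : C, (twist X).homᘁ = (twist Xᘁ).hom

section Ribbon

variable {C : Type u} [Category.{v} C] [Abelian C] [Linear ℂ C] [MonoidalCategory C]
  [MonoidalPreadditive C] [MonoidalLinear ℂ C] [BraidedCategory C] [RigidCategory C]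
  [PremodularCategory C]

/-- The twist `θ_X`. -/
def twist (X : C) : X ≅ X := PremodularCategory.twist X

/-- The evaluation `X ⊗ X* ⟶ 𝟙` of the ribbon structure. -/
def evRight (X : C) : X ⊗ Xᘁ ⟶ 𝟙_ C :=
  (twist X).hom ▷ Xᘁ ≫ (β_ X Xᘁ).hom ≫ ε_ X Xᘁ

/-- The (quantum) trace of an endomorphism, as a complex number. -/
def qTrace {X : C} (f : X ⟶ X) : ℂ :=
  scalar (η_ X Xᘁ ≫ f ▷ Xᘁ ≫ evRight X)

/-- The rotation of `Hom(𝟙, X ⊗ X)` which bends the last tensor leg around to the front, through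
the pivotal structure. -/
def rotation (X : C) : (𝟙_ C ⟶ X ⊗ X) →ₗ[ℂ] (𝟙_ C ⟶ X ⊗ X) where
  toFun f := η_ X Xᘁ ≫ X ◁ ((λ_ Xᘁ).inv ≫ f ▷ Xᘁ ≫ (α_ X X Xᘁ).hom ≫ X ◁ evRight X ≫ (ρ_ X).hom)
  map_add' f g := by
    simp [MonoidalPreadditive.add_whiskerRight, MonoidalPreadditive.whiskerLeft_add]
  map_smul' z f := by
    simp [MonoidalLinear.smul_whiskerRight, MonoidalLinear.whiskerLeft_smul]

/-- The (second) Frobenius–Schur indicator: the trace of the rotation of `Hom(𝟙, X ⊗ X)`. It is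
`0` if `X` is simple and not self-dual. -/
def frobeniusSchur (X : C) : ℂ := LinearMap.trace ℂ (𝟙_ C ⟶ X ⊗ X) (rotation X)

/-- The matrix of `R` symbols `[R^{XY}_Z]_{μν}` with respect to bases of the fusion spaces
`Hom(Z, X ⊗ Y)` and `Hom(Z, Y ⊗ X)`: the braiding maps the `μ`-th basis vector to
`∑ ν, [R]_{μν} • (ν-th basis vector)`. -/
def rMatrix {X Y Z : C} {m n : Type*} (b : Module.Basis m ℂ (Z ⟶ X ⊗ Y))
    (b' : Module.Basis n ℂ (Z ⟶ Y ⊗ X)) : Matrix m n ℂ :=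
  Matrix.of fun μ ν => b'.repr (b μ ≫ (β_ X Y).hom) ν

/-- Composition with the self-braiding of `X`, acting on the fusion space `Hom(Z, X ⊗ X)`. -/
def braidOp (X Z : C) : Module.End ℂ (Z ⟶ X ⊗ X) := Linear.rightComp ℂ Z (β_ X X).hom

namespace SimpleReps

variable {ι : Type w} (P : SimpleReps C ι)

/-- The fusion coefficient `N_{ab}^c`. -/
def fusion (a b c : ι) : ℕ := Module.finrank ℂ (P.obj c ⟶ P.obj a ⊗ P.obj b)

/-- The twist `θ_a` of a label, as a complex number. -/
def θ (a : ι) : ℂ := scalar (twist (P.obj a)).hom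

/-- The quantum dimension `d_a`. -/
def d (a : ι) : ℂ := qTrace (𝟙 (P.obj a))

/-- The unnormalised `S`-matrix: the invariant of the Hopf link with colours `a` and `b*`, that is
`∑_c N_{ab*}^c θ_c / (θ_a θ_b) d_c`. -/
def sTilde : Matrix ι ι ℂ := Matrix.of fun a b =>
  qTrace ((β_ (P.obj a) (P.obj b)ᘁ).hom ≫ (β_ (P.obj b)ᘁ (P.obj a)).hom)

/-- The total quantum dimension, the positive root of `D² = ∑_a d_a²` (which is real). -/
def D [Fintype ι] : ℝ := Real.sqrt (∑ a, P.d a ^ 2).re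

/-- The modular `S`-matrix. -/
def S [Fintype ι] : Matrix ι ι ℂ := ((P.D : ℂ)⁻¹) • P.sTilde

/-- `Λ_{a,c}`, relative to a square root `t` of `θ_c`: the signature of `(θ_a / t) R^{aa}_c`, that
is the multiplicity of the eigenvalue `1` minus the multiplicity of the eigenvalue `-1`. -/
def signature (t : ℂ) (a c : ι) : ℤ :=
  (Module.finrank ℂ (Module.End.eigenspace
      ((P.θ a / t) • braidOp (P.obj a) (P.obj c)) 1) : ℤ) -
    (Module.finrank ℂ (Module.End.eigenspace
      ((P.θ a / t) • braidOp (P.obj a) (P.obj c)) (-1)) : ℤ)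

end SimpleReps

end Ribbon

/-- A modular category: a premodular category with invertible `S`-matrix. -/
class ModularCategory (C : Type u) [Category.{v} C] [Abelian C] [Linear ℂ C]
    [MonoidalCategory C] [MonoidalPreadditive C] [MonoidalLinear ℂ C] [BraidedCategory C]
    [RigidCategory C] extends PremodularCategory C where
  nondegenerate : ∀ (n : ℕ) (P : SimpleReps C (Fin n)), IsUnit P.sTilde.det

/-- The expression
`∑_{x,y,z} θ_y² / (θ_a θ_x²) · S_{0y} S_{az} S_{xz}^* S_{cx}^* S_{yz}^* / S_{0z}`
in the modular data `(S, θ)` with vacuum label `o`; `star` is complex conjugation. -/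
def modularDataSum {ι : Type w} [Fintype ι] (S : Matrix ι ι ℂ) (θ : ι → ℂ) (o a c : ι) : ℂ :=
  ∑ x, ∑ y, ∑ z, θ y ^ 2 / (θ a * θ x ^ 2) *
    (S o y * S a z * star (S x z) * star (S c x) * star (S y z) / S o z)

end ModCat

end

/-! Close up the self-braiding of `a` and encircle it by a ring of colour `x`. Decomposing `a ⊗ a`
gives `∑_c tr(R^{aa}_c) H_{xc}`, with `H` the Hopf link invariant. Pulling the ring through instead
leaves the curl `θ_a` between two monodromies of `x` and `a`; these are scalars on each summand `y`
of `x ⊗ a`, giving `θ_a ∑_y N_{xa}^y d_y (θ_y/(θ_x θ_a))²` (`sum_trace_braidOp_mul_hopf`).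
Orthogonality of `H` isolates `tr(R^{aa}_c)`, and the Verlinde formula `sum_S_div` turns `N` into
`S` (`trace_braidOp`).

Orthogonality is derived, not assumed: the rows of `H` are `d_a` times characters of the fusion
ring, and Frobenius reciprocity with invertibility of `S` makes distinct characters orthogonal
(`char_sub_star_mul`, `sum_star_hopf_mul_hopf`).

By the ribbon axiom the squared braiding acts on `Hom(c, a ⊗ a)` as `θ_c/θ_a²`, so `(θ_a/t)
R^{aa}_c` is an involution, whose trace is its signature. On `Hom(𝟙, a ⊗ a)` the rotation is `θ_a`
times the braiding, which gives the Frobenius–Schur indicator. -/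

noncomputable section

namespace ModCat

universe v u w

set_option linter.unusedSectionVars false

/-! ### Partial traces in a ribbon category. -/

section PartialTrace

open BraidedCategory

variable {C : Type u} [Category.{v} C] [Abelian C] [Linear ℂ C] [MonoidalCategory C]
  [MonoidalPreadditive C] [MonoidalLinear ℂ C] [BraidedCategory C] [RigidCategory C]
  [PremodularCategory C]

/-- The right partial trace over `Y`. -/
def ptr {X X' Y : C} (f : X ⊗ Y ⟶ X' ⊗ Y) : X ⟶ X' :=
  (ρ_ X).inv ≫ X ◁ η_ Y Yᘁ ≫ (α_ X Y Yᘁ).inv ≫ f ▷ Yᘁ ≫ (α_ X' Y Yᘁ).hom ≫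
    X' ◁ evRight Y ≫ (ρ_ X').hom

lemma ptr_add {X X' Y : C} (f g : X ⊗ Y ⟶ X' ⊗ Y) : ptr (f + g) = ptr f + ptr g := by
  simp [ptr, MonoidalPreadditive.add_whiskerRight]

lemma ptr_smul {X X' Y : C} (z : ℂ) (f : X ⊗ Y ⟶ X' ⊗ Y) : ptr (z • f) = z • ptr f := by
  simp [ptr, MonoidalLinear.smul_whiskerRight]

lemma ptr_whiskerRight_comp {X₁ X X' Y : C} (g : X₁ ⟶ X) (f : X ⊗ Y ⟶ X' ⊗ Y) :
    ptr (g ▷ Y ≫ f) = g ≫ ptr f := by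
  unfold ptr
  calc _ = 𝟙 _ ⊗≫ (X₁ ◁ η_ Y Yᘁ ≫ g ▷ (Y ⊗ Yᘁ)) ⊗≫ f ▷ Yᘁ ⊗≫ X' ◁ evRight Y ⊗≫ 𝟙 _ := by monoidal
    _ = _ := by rw [whisker_exchange]; monoidal

lemma ptr_comp_whiskerRight {X X' X₁ Y : C} (f : X ⊗ Y ⟶ X' ⊗ Y) (g : X' ⟶ X₁) :
    ptr (f ≫ g ▷ Y) = ptr f ≫ g := by
  unfold ptr
  calc _ = 𝟙 _ ⊗≫ X ◁ η_ Y Yᘁ ⊗≫ f ▷ Yᘁ ⊗≫ (g ▷ (Y ⊗ Yᘁ) ≫ X₁ ◁ evRight Y) ⊗≫ 𝟙 _ := by monoidal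
    _ = _ := by rw [← whisker_exchange]; monoidal

lemma ptr_whiskerRight_comp_comp {X₀ X X' X₁ Y : C} (g : X₀ ⟶ X) (f : X ⊗ Y ⟶ X' ⊗ Y)
    (h : X' ⟶ X₁) : ptr (g ▷ Y ≫ f ≫ h ▷ Y) = g ≫ ptr f ≫ h := by
  rw [ptr_whiskerRight_comp, ptr_comp_whiskerRight]

/-- Twist and braiding are natural, so this reduces to dinaturality of `ε_`; cyclicity of the
partial trace rests on it. -/
lemma whiskerRight_evRight {Y Y' : C} (g : Y ⟶ Y') :
    g ▷ Y'ᘁ ≫ evRight Y' = Y ◁ gᘁ ≫ evRight Y := by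
  unfold evRight
  rw [← comp_whiskerRight_assoc, show g ≫ (twist Y').hom = (twist Y).hom ≫ g from
    PremodularCategory.twist_naturality g, comp_whiskerRight_assoc, braiding_naturality_left_assoc,
    whisker_exchange_assoc, braiding_naturality_right_assoc, rightAdjointMate_comp_evaluation]

/-- The partial trace is cyclic. -/
lemma ptr_comp_whiskerLeft {X X' Y Y' : C} (f : X ⊗ Y ⟶ X' ⊗ Y') (g : Y' ⟶ Y) :
    ptr (f ≫ X' ◁ g) = ptr (X ◁ g ≫ f) := by
  unfold ptr
  calc _ = 𝟙 _ ⊗≫ X ◁ η_ Y Yᘁ ⊗≫ f ▷ Yᘁ ⊗≫ X' ◁ (g ▷ Yᘁ ≫ evRight Y) ⊗≫ 𝟙 _ := by monoidal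
    _ = 𝟙 _ ⊗≫ X ◁ η_ Y Yᘁ ⊗≫ (f ▷ Yᘁ ≫ (X' ⊗ Y') ◁ gᘁ) ⊗≫ X' ◁ evRight Y' ⊗≫ 𝟙 _ := by
      rw [whiskerRight_evRight]; monoidal
    _ = 𝟙 _ ⊗≫ X ◁ (η_ Y Yᘁ ≫ Y ◁ gᘁ) ⊗≫ f ▷ Y'ᘁ ⊗≫ X' ◁ evRight Y' ⊗≫ 𝟙 _ := by
      rw [← whisker_exchange]; monoidal
    _ = _ := by rw [coevaluation_comp_rightAdjointMate]; monoidal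

lemma ptr_whiskerLeft {W X X' Y : C} (f : X ⊗ Y ⟶ X' ⊗ Y) :
    ptr ((α_ W X Y).hom ≫ W ◁ f ≫ (α_ W X' Y).inv) = W ◁ ptr f := by
  unfold ptr
  monoidal

/-- The partial trace of the self-braiding is the twist. -/
lemma ptr_braiding (X : C) : ptr (β_ X X).hom = (twist X).hom := by
  unfold ptr evRight
  calc _ = 𝟙 _ ⊗≫ X ◁ η_ X Xᘁ ⊗≫ ((β_ X X).hom ≫ X ◁ (twist X).hom) ▷ Xᘁ ⊗≫
          X ◁ (β_ X Xᘁ).hom ⊗≫ X ◁ ε_ X Xᘁ ⊗≫ 𝟙 _ := by monoidal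
    _ = 𝟙 _ ⊗≫ (X ◁ η_ X Xᘁ ≫ (twist X).hom ▷ (X ⊗ Xᘁ)) ⊗≫ ((β_ X X).hom ▷ Xᘁ ⊗≫
          X ◁ (β_ X Xᘁ).hom) ⊗≫ X ◁ ε_ X Xᘁ ⊗≫ 𝟙 _ := by
      rw [← braiding_naturality_left]; monoidal
    -- The two crossings form one braiding of `X` past `X ⊗ Xᘁ`, which naturality slides off the
    -- coevaluation; a zigzag remains.
    _ = 𝟙 _ ⊗≫ (twist X).hom ▷ (𝟙_ C) ⊗≫ (X ◁ η_ X Xᘁ ≫ (β_ X (X ⊗ Xᘁ)).hom) ⊗≫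
          X ◁ ε_ X Xᘁ ⊗≫ 𝟙 _ := by
      rw [whisker_exchange, braiding_tensor_right_hom]; monoidal
    _ = (twist X).hom ⊗≫ (η_ X Xᘁ ▷ X ⊗≫ X ◁ ε_ X Xᘁ) ⊗≫ 𝟙 _ := by
      rw [braiding_naturality_right, braiding_tensorUnit_right]; monoidal
    _ = _ := by rw [ExactPairing.evaluation_coevaluation'']; monoidal

/-- The evaluation of the ribbon structure, for an arbitrary right dual. -/
def evPair (X Y : C) [ExactPairing X Y] : X ⊗ Y ⟶ 𝟙_ C :=
  (twist X).hom ▷ Y ≫ (β_ X Y).hom ≫ ε_ X Y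

/-- A strand `Y` passes the closed cap freely, because braiding with the unit is trivial. -/
lemma braiding_evaluation_slide (X X' Y : C) [ExactPairing X X'] :
    Y ◁ ((β_ X X').hom ≫ ε_ X X') = (α_ Y X X').inv ≫ (β_ Y X).hom ▷ X' ≫ (α_ X Y X').hom ≫
      X ◁ (β_ Y X').hom ≫ (α_ X X' Y).inv ≫ ((β_ X X').hom ≫ ε_ X X') ▷ Y ≫
      (λ_ Y).hom ≫ (ρ_ Y).inv := by
  have h := braiding_naturality_right Y ((β_ X X').hom ≫ ε_ X X')
  rw [← cancel_mono (β_ Y (𝟙_ C)).hom, h, braiding_tensor_right_hom, braiding_tensorUnit_right]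
  simp

/-- Multiplicativity of the ribbon evaluation. -/
lemma evPair_tensor (X Y X' Y' : C) [ExactPairing X X'] [ExactPairing Y Y'] :
    evPair (X ⊗ Y) (Y' ⊗ X') =
      𝟙 _ ⊗≫ X ◁ evPair Y Y' ▷ X' ⊗≫ evPair X X' := by
  unfold evPair
  have tw : (twist (X ⊗ Y)).hom =
    ((twist X).hom ⊗ₘ (twist Y).hom) ≫ (β_ X Y).hom ≫ (β_ Y X).hom :=
    PremodularCategory.twist_tensor X Y
  have h1 : X ◁ (β_ Y X').hom ≫ (α_ X X' Y).inv ≫ ((β_ X X').hom ≫ ε_ X X') ▷ Y =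
      (α_ X Y X').inv ≫ (β_ Y X).inv ▷ X' ≫ (α_ Y X X').hom ≫
        Y ◁ ((β_ X X').hom ≫ ε_ X X') ≫ (ρ_ Y).hom ≫ (λ_ Y).inv := by
    rw [braiding_evaluation_slide]; simp
  have h2 : Y ◁ (β_ X Y').hom ≫ (α_ Y Y' X).inv ≫ ((β_ Y Y').hom ≫ ε_ Y Y') ▷ X =
      (α_ Y X Y').inv ≫ (β_ X Y).inv ▷ Y' ≫ (α_ X Y Y').hom ≫
        X ◁ ((β_ Y Y').hom ≫ ε_ Y Y') ≫ (ρ_ X).hom ≫ (λ_ X).inv := by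
    rw [braiding_evaluation_slide]; simp
  have key : (β_ (X ⊗ Y) (Y' ⊗ X')).hom ≫ ε_ (X ⊗ Y) (Y' ⊗ X') =
      ((β_ Y X).inv ≫ (β_ X Y).inv) ▷ (Y' ⊗ X') ⊗≫
        X ◁ ((β_ Y Y').hom ≫ ε_ Y Y') ▷ X' ⊗≫ ((β_ X X').hom ≫ ε_ X X') := by
    rw [ExactPairing.tensor_evaluation, braiding_tensor_right_hom]
    calc _ = 𝟙 _ ⊗≫ (β_ (X ⊗ Y) Y').hom ▷ X' ⊗≫ Y' ◁ ((β_ (X ⊗ Y) X').hom ⊗≫ ε_ X X' ▷ Y) ⊗≫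
          ε_ Y Y' := by monoidal
      _ = 𝟙 _ ⊗≫ (β_ (X ⊗ Y) Y').hom ▷ X' ⊗≫ Y' ◁ (X ◁ (β_ Y X').hom ≫ (α_ X X' Y).inv ≫
          ((β_ X X').hom ≫ ε_ X X') ▷ Y) ⊗≫ ε_ Y Y' := by
        rw [braiding_tensor_left_hom X Y X']; monoidal
      _ = 𝟙 _ ⊗≫ ((β_ (X ⊗ Y) Y').hom ≫ Y' ◁ (β_ Y X).inv) ▷ X' ⊗≫
          ((Y' ⊗ Y) ◁ ((β_ X X').hom ≫ ε_ X X') ≫ ε_ Y Y' ▷ (𝟙_ C)) ⊗≫ 𝟙 _ := by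
        rw [h1]; monoidal
      _ = 𝟙 _ ⊗≫ ((β_ Y X).inv ▷ Y' ≫ (β_ (Y ⊗ X) Y').hom) ▷ X' ⊗≫
          (ε_ Y Y' ▷ (X ⊗ X') ≫ (𝟙_ C) ◁ ((β_ X X').hom ≫ ε_ X X')) ⊗≫ 𝟙 _ := by
        rw [whisker_exchange, braiding_naturality_left]
      _ = (β_ Y X).inv ▷ (Y' ⊗ X') ⊗≫ (Y ◁ (β_ X Y').hom ≫ (α_ Y Y' X).inv ≫
          ((β_ Y Y').hom ≫ ε_ Y Y') ▷ X) ▷ X' ⊗≫ ((β_ X X').hom ≫ ε_ X X') := by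
        rw [braiding_tensor_left_hom]; monoidal
      _ = _ := by rw [h2]; monoidal
  rw [key, tw]
  -- The double braiding inside the twist of `X ⊗ Y` cancels exactly the inverse crossings in `key`.
  have c : ((β_ X Y).hom ≫ (β_ Y X).hom) ≫ ((β_ Y X).inv ≫ (β_ X Y).inv) = 𝟙 _ := by simp
  calc _ = ((twist X).hom ⊗ₘ (twist Y).hom) ▷ _ ≫ (((β_ X Y).hom ≫ (β_ Y X).hom) ≫
        ((β_ Y X).inv ≫ (β_ X Y).inv)) ▷ (Y' ⊗ X') ⊗≫
        X ◁ ((β_ Y Y').hom ≫ ε_ Y Y') ▷ X' ⊗≫ ((β_ X X').hom ≫ ε_ X X') := by monoidal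
    _ = 𝟙 _ ⊗≫ ((twist X).hom ▷ ((Y ⊗ Y') ⊗ X') ≫ X ◁ ((twist Y).hom ▷ Y' ≫ (β_ Y Y').hom ≫ ε_ Y Y') ▷ X')
         ⊗≫ ((β_ X X').hom ≫ ε_ X X') := by rw [c, MonoidalCategory.tensorHom_def]; monoidal
    _ = 𝟙 _ ⊗≫ ((twist X).hom ▷ (Y ⊗ Y') ≫ X ◁ ((twist Y).hom ▷ Y' ≫ (β_ Y Y').hom ≫ ε_ Y Y')) ▷ X'
         ⊗≫ ((β_ X X').hom ≫ ε_ X X') := by monoidal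
    _ = _ := by rw [← whisker_exchange]; monoidal


/-- Right duals are unique up to an isomorphism `w` matching `η_` and `ε_`. This permits `Zᘁ ⊗ Yᘁ`
as the dual of `Y ⊗ Z`, and `X` as the dual of `Xᘁ`. -/
lemma ptr_eq_of_exactPairing {X X' Y : C} (Y' : C) [ExactPairing Y Y'] (f : X ⊗ Y ⟶ X' ⊗ Y) :
    ptr f = 𝟙 _ ⊗≫ X ◁ η_ Y Y' ⊗≫ f ▷ Y' ⊗≫ X' ◁ evPair Y Y' ⊗≫ 𝟙 _ := by
  let w : Y' ⟶ Yᘁ := @rightAdjointMate C _ _ Y Y ⟨Yᘁ⟩ ⟨Y'⟩ (𝟙 Y)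
  have hη : η_ Y Y' ≫ Y ◁ w = η_ Y Yᘁ := by
    have := @coevaluation_comp_rightAdjointMate C _ _ Y Y ⟨Yᘁ⟩ ⟨Y'⟩ (𝟙 Y)
    exact this.trans (by simp)
  have hε : w ▷ Y ≫ ε_ Y Yᘁ = ε_ Y Y' := by
    have := @rightAdjointMate_comp_evaluation C _ _ Y Y ⟨Yᘁ⟩ ⟨Y'⟩ (𝟙 Y)
    exact this.trans (by simp)
  have hev : Y ◁ w ≫ evRight Y = evPair Y Y' := by
    unfold evRight evPair
    rw [whisker_exchange_assoc, braiding_naturality_right_assoc, hε]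
  rw [← hev, ptr, ← hη]
  calc _ = 𝟙 _ ⊗≫ X ◁ η_ Y Y' ⊗≫ ((X ⊗ Y) ◁ w ≫ f ▷ Yᘁ) ⊗≫ X' ◁ evRight Y ⊗≫ 𝟙 _ := by monoidal
    _ = _ := by rw [whisker_exchange]; monoidal

lemma ptr_tensor {X X' Y Z : C} (f : X ⊗ (Y ⊗ Z) ⟶ X' ⊗ (Y ⊗ Z)) :
    ptr f = ptr (ptr ((α_ X Y Z).hom ≫ f ≫ (α_ X' Y Z).inv)) := by
  rw [ptr_eq_of_exactPairing (Zᘁ ⊗ Yᘁ), ptr_eq_of_exactPairing Yᘁ,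
    ptr_eq_of_exactPairing Zᘁ, evPair_tensor, ExactPairing.tensor_coevaluation]
  monoidal

lemma qTrace_eq_scalar_ptr {X : C} (f : X ⟶ X) :
    qTrace f = scalar (ptr ((λ_ X).hom ≫ f ≫ (λ_ X).inv)) := by
  unfold qTrace ptr
  congr 1
  monoidal

lemma qTrace_comm {X Y : C} (f : X ⟶ Y) (g : Y ⟶ X) : qTrace (f ≫ g) = qTrace (g ≫ f) := by
  rw [qTrace_eq_scalar_ptr, qTrace_eq_scalar_ptr]
  congr 1
  have := ptr_comp_whiskerLeft ((λ_ X).hom ≫ f ≫ (λ_ Y).inv) g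
  simpa using this

/-- The quantum trace of an endomorphism of a tensor product is the quantum trace of its partial
trace. -/
lemma qTrace_ptr {X Y : C} (f : X ⊗ Y ⟶ X ⊗ Y) : qTrace (ptr f) = qTrace f := by
  rw [qTrace_eq_scalar_ptr, qTrace_eq_scalar_ptr, ptr_tensor, ← ptr_whiskerRight_comp_comp]
  congr 3
  simp

end PartialTrace

/-! ### Monodromy, encircling rings and the rotation. -/

section DoubleBraiding

open BraidedCategory

variable {C : Type u} [Category.{v} C] [Abelian C] [Linear ℂ C] [MonoidalCategory C]
  [MonoidalPreadditive C] [MonoidalLinear ℂ C] [BraidedCategory C] [RigidCategory C]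
  [PremodularCategory C]

/-- The double braiding (monodromy) of `X` and `Y`. -/
def monodromy (X Y : C) : X ⊗ Y ⟶ X ⊗ Y := (β_ X Y).hom ≫ (β_ Y X).hom

lemma monodromy_naturality_right (X : C) {Y Z : C} (f : Y ⟶ Z) :
    monodromy X Y ≫ X ◁ f = X ◁ f ≫ monodromy X Z := by
  simp [monodromy]

lemma monodromy_tensor (X Y Z : C) : (α_ X Y Z).hom ≫ monodromy X (Y ⊗ Z) ≫ (α_ X Y Z).inv =
    (β_ X Y).hom ▷ Z ≫ ((α_ Y X Z).hom ≫ Y ◁ monodromy X Z ≫ (α_ Y X Z).inv) ≫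
      (β_ Y X).hom ▷ Z := by
  simp [monodromy, braiding_tensor_right_hom, braiding_tensor_left_hom]

lemma ptr_monodromy_tensor (X Y Z : C) : ptr (monodromy X (Y ⊗ Z)) =
    ptr ((β_ X Y).hom ≫ Y ◁ ptr (monodromy X Z) ≫ (β_ Y X).hom) := by
  rw [ptr_tensor, monodromy_tensor, ptr_whiskerRight_comp_comp, ptr_whiskerLeft]

/-- Naturality of the braiding with `Y`, applied to the monodromy of `X` and `Y`, carries the
crossing of the two `Y` strands between two copies of that monodromy. -/
lemma monodromy_tensor_self_comp_braiding (X Y : C) :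
    (α_ X Y Y).hom ≫ (monodromy X (Y ⊗ Y) ≫ X ◁ (β_ Y Y).hom) ≫ (α_ X Y Y).inv =
      monodromy X Y ▷ Y ≫ ((α_ X Y Y).hom ≫ X ◁ (β_ Y Y).hom ≫ (α_ X Y Y).inv) ≫
        monodromy X Y ▷ Y := by
  have h := braiding_naturality_right Y (monodromy X Y)
  rw [braiding_tensor_right_hom] at h
  have h' := monodromy_tensor X Y Y
  calc _ = ((α_ X Y Y).hom ≫ monodromy X (Y ⊗ Y) ≫ (α_ X Y Y).inv) ≫
        (α_ X Y Y).hom ≫ X ◁ (β_ Y Y).hom ≫ (α_ X Y Y).inv := by simp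
    _ = (β_ X Y).hom ▷ Y ≫ (α_ Y X Y).hom ≫ (Y ◁ monodromy X Y ≫ (α_ Y X Y).inv ≫
      (β_ Y X).hom ▷ Y ≫ (α_ X Y Y).hom ≫ X ◁ (β_ Y Y).hom ≫ (α_ X Y Y).inv) := by
      rw [h']; simp
    _ = _ := by rw [h]; simp [monodromy]

/-- Encircling the closure of the self-braiding of `Y` by a strand of colour `X`. -/
lemma ptr_monodromy_comp_braiding (X Y : C) :
    ptr (monodromy X (Y ⊗ Y) ≫ X ◁ (β_ Y Y).hom) =
      ptr (monodromy X Y ≫ X ◁ (twist Y).hom ≫ monodromy X Y) := by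
  -- Both monodromies avoid the traced strand and leave the partial trace; only the crossing is
  -- closed up, into a twist.
  rw [ptr_tensor, monodromy_tensor_self_comp_braiding, ptr_whiskerRight_comp_comp,
    ptr_whiskerLeft, ptr_braiding]

lemma twist_tensor_hom (X Y : C) : (twist (X ⊗ Y)).hom =
    ((twist X).hom ⊗ₘ (twist Y).hom) ≫ monodromy X Y :=
  PremodularCategory.twist_tensor X Y

lemma twist_naturality {X Y : C} (f : X ⟶ Y) : f ≫ (twist Y).hom = (twist X).hom ≫ f :=
  PremodularCategory.twist_naturality f

lemma twist_rightDual (X : C) : (twist Xᘁ).hom = (twist X).homᘁ :=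
  (PremodularCategory.twist_dual X).symm

/-- The rotation is the composition with the twisted self-braiding. -/
lemma rotation_apply (X : C) (f : 𝟙_ C ⟶ X ⊗ X) :
    rotation X f = f ≫ X ◁ (twist X).hom ≫ (β_ X X).hom := by
  -- Sliding `f` past the `X` strand presents the rotation as `f` followed by a partial trace of two
  -- crossings; by `h2` one closes to the twist and the other survives.
  have h1 : X ◁ f = (ρ_ X).hom ≫ (λ_ X).inv ≫ f ▷ X ≫ (β_ (X ⊗ X) X).hom := by
    rw [braiding_naturality_left, braiding_tensorUnit_left]; simp
  have h2 : ptr ((α_ X X X).hom ≫ X ◁ (β_ X X).hom ≫ (α_ X X X).inv ≫ (β_ X X).hom ▷ X) =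
      X ◁ (twist X).hom ≫ (β_ X X).hom := by
    have := ptr_comp_whiskerRight ((α_ X X X).hom ≫ X ◁ (β_ X X).hom ≫ (α_ X X X).inv)
      (β_ X X).hom
    rw [ptr_whiskerLeft, ptr_braiding] at this
    simpa using this
  rw [← h2]
  unfold ptr rotation
  dsimp
  calc _ = η_ X Xᘁ ⊗≫ (X ◁ f) ▷ Xᘁ ⊗≫ (X ⊗ X) ◁ evRight X ⊗≫ 𝟙 _ := by monoidal
    _ = 𝟙 _ ⊗≫ ((𝟙_ C) ◁ η_ X Xᘁ ≫ f ▷ (X ⊗ Xᘁ)) ⊗≫ (β_ (X ⊗ X) X).hom ▷ Xᘁ ⊗≫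
        (X ⊗ X) ◁ evRight X ⊗≫ 𝟙 _ := by rw [h1]; monoidal
    _ = _ := by rw [whisker_exchange, braiding_tensor_left_hom]; monoidal

/-- With `X` as dual of `Xᘁ` through the swapped pairing, both traces become the same loop once the
twist is moved across the coevaluation by duality. -/
lemma qTrace_rightDual (X : C) : qTrace (𝟙 Xᘁ) = qTrace (𝟙 X) := by
  let _ : ExactPairing Xᘁ X := exactPairing_swap X Xᘁ
  rw [qTrace_eq_scalar_ptr, ptr_eq_of_exactPairing X]
  unfold qTrace
  congr 1
  have e1 : η_ Xᘁ X = η_ X Xᘁ ≫ (β_ Xᘁ X).inv := rfl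
  have e2 : ε_ Xᘁ X = (β_ X Xᘁ).hom ≫ ε_ X Xᘁ := rfl
  unfold evPair evRight
  rw [e1, e2, twist_rightDual]
  calc _ = η_ X Xᘁ ≫ (β_ Xᘁ X).inv ≫ (twist X).homᘁ ▷ X ≫ (β_ Xᘁ X).hom ≫ (β_ X Xᘁ).hom ≫
        ε_ X Xᘁ := by monoidal
    _ = _ := by
      rw [braiding_naturality_left_assoc, Iso.inv_hom_id_assoc, ← Category.assoc,
        coevaluation_comp_rightAdjointMate]
      simp

end DoubleBraiding

/-! ### Semisimplicity: cyclic traces are determined on simple objects. -/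

section Semisimple

variable {C : Type u} [Category.{v} C] [Abelian C] [Linear ℂ C] [MonoidalCategory C]
  [MonoidalPreadditive C] [MonoidalLinear ℂ C] [BraidedCategory C] [RigidCategory C]
  [PremodularCategory C]

instance instFiniteDimensionalHom (X Y : C) : FiniteDimensional ℂ (X ⟶ Y) :=
  PremodularCategory.finiteDimensional_hom X Y

instance instSimpleUnit : Simple (𝟙_ C) := PremodularCategory.simple_unit

lemma eq_scalar_smul_id {X : C} [Simple X] (f : X ⟶ X) : f = scalar f • 𝟙 X := by
  obtain ⟨z, hz⟩ := endomorphism_simple_eq_smul_id ℂ f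
  have h : ∃ z : ℂ, f = z • 𝟙 X := ⟨z, hz.symm⟩
  rw [scalar, dif_pos h]
  exact h.choose_spec

lemma scalar_eq {X : C} [Simple X] {f : X ⟶ X} {z : ℂ} (h : f = z • 𝟙 X) : scalar f = z := by
  have h' := eq_scalar_smul_id f
  rw [h] at h'
  exact (smul_left_injective ℂ (id_nonzero X) h').symm ▸ by rw [h]

/-- The scalar of an endomorphism of a simple object, as a linear map. -/
def scalarₗ (X : C) [Simple X] : (X ⟶ X) →ₗ[ℂ] ℂ where
  toFun := scalar
  map_add' f g := scalar_eq (by rw [add_smul, ← eq_scalar_smul_id, ← eq_scalar_smul_id])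
  map_smul' z f := scalar_eq (by simp [mul_smul, ← eq_scalar_smul_id])

lemma scalar_add {X : C} [Simple X] (f g : X ⟶ X) : scalar (f + g) = scalar f + scalar g :=
  (scalarₗ X).map_add f g

lemma scalar_smul {X : C} [Simple X] (z : ℂ) (f : X ⟶ X) : scalar (z • f) = z * scalar f :=
  (scalarₗ X).map_smul z f

variable (C) in
/-- A family of linear functionals on endomorphism spaces which is invariant under cyclic
permutations. -/
structure CyclicTrace where
  toFun : ∀ X : C, (X ⟶ X) →ₗ[ℂ] ℂ
  comm : ∀ {X Y : C} (f : X ⟶ Y) (g : Y ⟶ X), toFun X (f ≫ g) = toFun Y (g ≫ f)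

variable (C) in
/-- The quantum trace as a cyclic trace. -/
def qCyclicTrace : CyclicTrace C where
  toFun X :=
    { toFun := qTrace
      map_add' f g := by
        simp [qTrace_eq_scalar_ptr, Preadditive.add_comp, Preadditive.comp_add, ptr_add, scalar_add]
      map_smul' z f := by simp [qTrace_eq_scalar_ptr, ptr_smul, scalar_smul] }
  comm f g := qTrace_comm f g

/-- The cyclic trace given by encircling a strand of simple colour `X`. -/
def ringTrace (X : C) [Simple X] : CyclicTrace C where
  toFun Y :=
    { toFun f := scalar (ptr (monodromy X Y ≫ X ◁ f))
      map_add' f g := by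
        simp [MonoidalPreadditive.whiskerLeft_add, Preadditive.comp_add, ptr_add, scalar_add]
      map_smul' z f := by simp [MonoidalLinear.whiskerLeft_smul, ptr_smul, scalar_smul] }
  comm {Y Z} f g := by
    dsimp
    rw [whiskerLeft_comp, ← Category.assoc, ptr_comp_whiskerLeft, ← Category.assoc,
      ← monodromy_naturality_right, Category.assoc, whiskerLeft_comp]

lemma rightComp_comp (W : C) {X Y Z : C} (f : X ⟶ Y) (g : Y ⟶ Z) :
    Linear.rightComp ℂ W (f ≫ g) = Linear.rightComp ℂ W g ∘ₗ Linear.rightComp ℂ W f := by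
  ext; simp

lemma leftComp_comp (W : C) {X Y Z : C} (f : X ⟶ Y) (g : Y ⟶ Z) :
    Linear.leftComp ℂ W (f ≫ g) = Linear.leftComp ℂ W f ∘ₗ Linear.leftComp ℂ W g := by
  ext; simp

/-- The trace of the action of an endomorphism of `X` on `Hom(Z, X)`. -/
def homTrace (Z : C) : CyclicTrace C where
  toFun X :=
    { toFun f := LinearMap.trace ℂ (Z ⟶ X) (Linear.rightComp ℂ Z f)
      map_add' f g := by
        rw [← map_add]; congr 1; ext; simp
      map_smul' z f := by
        rw [RingHom.id_apply, ← map_smul]; congr 1; ext; simp }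
  comm f g := by
    change LinearMap.trace ℂ _ (Linear.rightComp ℂ Z (f ≫ g)) =
      LinearMap.trace ℂ _ (Linear.rightComp ℂ Z (g ≫ f))
    rw [rightComp_comp, rightComp_comp, LinearMap.trace_comp_comm']

/-- The trace of the action of an endomorphism of `X` on `Hom(X, Z)`. -/
def cohomTrace (Z : C) : CyclicTrace C where
  toFun X :=
    { toFun f := LinearMap.trace ℂ (X ⟶ Z) (Linear.leftComp ℂ Z f)
      map_add' f g := by
        rw [← map_add]; congr 1; ext; simp
      map_smul' z f := by
        rw [RingHom.id_apply, ← map_smul]; congr 1; ext; simp }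
  comm f g := by
    change LinearMap.trace ℂ _ (Linear.leftComp ℂ Z (f ≫ g)) =
      LinearMap.trace ℂ _ (Linear.leftComp ℂ Z (g ≫ f))
    rw [leftComp_comp, leftComp_comp, LinearMap.trace_comp_comm']

lemma qCyclicTrace_apply {X : C} (f : X ⟶ X) : (qCyclicTrace C).toFun X f = qTrace f := rfl

lemma ringTrace_apply (X : C) [Simple X] {Y : C} (f : Y ⟶ Y) :
    (ringTrace X).toFun Y f = scalar (ptr (monodromy X Y ≫ X ◁ f)) := rfl

lemma homTrace_apply (Z : C) {X : C} (f : X ⟶ X) :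
    (homTrace Z).toFun X f = LinearMap.trace ℂ (Z ⟶ X) (Linear.rightComp ℂ Z f) := rfl

lemma homTrace_id (Z X : C) : (homTrace Z).toFun X (𝟙 X) = Module.finrank ℂ (Z ⟶ X) := by
  rw [homTrace_apply, show Linear.rightComp ℂ Z (𝟙 X) = LinearMap.id by ext; simp,
    LinearMap.trace_id]

lemma cohomTrace_id (Z X : C) : (cohomTrace Z).toFun X (𝟙 X) = Module.finrank ℂ (X ⟶ Z) := by
  change LinearMap.trace ℂ (X ⟶ Z) (Linear.leftComp ℂ Z (𝟙 X)) = _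
  rw [show Linear.leftComp ℂ Z (𝟙 X) = LinearMap.id by ext; simp, LinearMap.trace_id]

lemma CyclicTrace.id_eq_of_iso (τ : CyclicTrace C) {X Y : C} (e : X ≅ Y) :
    τ.toFun X (𝟙 X) = τ.toFun Y (𝟙 Y) := by
  rw [← e.hom_inv_id, τ.comm, e.inv_hom_id]

lemma exists_decomposition (X : C) : ∃ (n : ℕ) (s : Fin n → C) (i : ∀ j, s j ⟶ X)
    (p : ∀ j, X ⟶ s j), (∀ j, Simple (s j)) ∧ (∀ j, i j ≫ p j = 𝟙 _) ∧
      ∑ j, p j ≫ i j = 𝟙 X := by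
  obtain ⟨n, s, B, hs, ⟨hB⟩, ⟨e⟩⟩ := PremodularCategory.semisimple X
  refine ⟨n, s, fun j => B.ι j ≫ e.inv, fun j => e.hom ≫ B.π j, hs, fun j => by simp, ?_⟩
  have h := Limits.IsBilimit.total hB
  calc _ = e.hom ≫ (∑ j, B.π j ≫ B.ι j) ≫ e.inv := by
        simp [Preadditive.sum_comp, Preadditive.comp_sum]
    _ = _ := by rw [h]; simp

/-- An object whose endomorphisms are all scalars is simple. -/
lemma simple_of_finrank_end {X : C} (h : Module.finrank ℂ (X ⟶ X) = 1) : Simple X := by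
  obtain ⟨n, s, i, p, hs, hip, htot⟩ := exists_decomposition X
  have hid : 𝟙 X ≠ 0 := by
    intro h0
    have : Subsingleton (X ⟶ X) :=
      ⟨fun f g => by rw [← Category.comp_id f, ← Category.comp_id g, h0]; simp⟩
    rw [Module.finrank_zero_of_subsingleton] at h
    exact zero_ne_one h
  obtain ⟨j⟩ : Nonempty (Fin n) := by
    by_contra hn
    rw [not_nonempty_iff] at hn
    exact hid (by rw [← htot, Finset.univ_eq_empty, Finset.sum_empty])
  -- The idempotent of one summand is a multiple of the identity, and compressing to the summand
  -- forces the factor to be `1`.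
  obtain ⟨k, hk⟩ := (finrank_eq_one_iff_of_nonzero' (𝟙 X) hid).mp h (p j ≫ i j)
  have := hs j
  have h1 : k • 𝟙 (s j) = 𝟙 (s j) := by
    calc k • 𝟙 (s j) = i j ≫ (k • 𝟙 X) ≫ p j := by simp [hip]
      _ = _ := by rw [hk]; simp [hip]
  have hk1 : k = 1 :=
    smul_left_injective ℂ (id_nonzero (s j)) (by simpa using h1)
  refine Simple.of_iso (Y := s j) ⟨p j, i j, ?_, hip j⟩
  rw [← hk, hk1, one_smul]

namespace SimpleReps

variable {ι : Type w} (P : SimpleReps C ι)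

instance instSimpleObj (a : ι) : Simple (P.obj a) := P.simple a

open Classical in
lemma finrank_hom (a b : ι) :
    Module.finrank ℂ (P.obj a ⟶ P.obj b) = if a = b then 1 else 0 := by
  rw [finrank_hom_simple_simple ℂ]
  congr 1
  exact propext ⟨fun h => P.eq_of_iso a b h, fun h => ⟨eqToIso (by rw [h])⟩⟩

/-- The coefficients do not depend on `τ`, so any cyclic trace can be compared with `homTrace` and
`cohomTrace`. -/
lemma exists_expansion (X : C) : ∃ (n : ℕ) (l : (X ⟶ X) → Fin n → ℂ) (a : Fin n → ι),
    ∀ (τ : CyclicTrace C) (f : X ⟶ X),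
      τ.toFun X f = ∑ j, l f j * τ.toFun (P.obj (a j)) (𝟙 _) := by
  obtain ⟨n, s, i, p, hs, -, htot⟩ := exists_decomposition X
  choose a ha using fun j => P.exists_iso (s j) (hs j)
  refine ⟨n, fun f j => scalar (i j ≫ f ≫ p j), a, fun τ f => ?_⟩
  calc τ.toFun X f = τ.toFun X (∑ j, (f ≫ p j) ≫ i j) := by
        simp only [Category.assoc, ← Preadditive.comp_sum, htot, Category.comp_id]
    _ = ∑ j, τ.toFun (s j) (i j ≫ f ≫ p j) := by
        rw [map_sum]; exact Finset.sum_congr rfl fun j _ => τ.comm _ _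
    _ = _ := by
        refine Finset.sum_congr rfl fun j _ => ?_
        have := hs j
        conv_lhs => rw [eq_scalar_smul_id (i j ≫ f ≫ p j)]
        rw [map_smul, smul_eq_mul, τ.id_eq_of_iso (ha j).some]

/-- A cyclic trace is determined by its values on the identities of simple objects. -/
lemma cyclicTrace_eq_sum [Fintype ι] (τ : CyclicTrace C) {X : C} (f : X ⟶ X) :
    τ.toFun X f = ∑ c, τ.toFun (P.obj c) (𝟙 _) * (homTrace (P.obj c)).toFun X f := by
  classical
  obtain ⟨n, l, a, h⟩ := P.exists_expansion X
  rw [h]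
  simp_rw [h (homTrace _), homTrace_id, P.finrank_hom, Finset.mul_sum]
  rw [Finset.sum_comm]
  refine Finset.sum_congr rfl fun j _ => ?_
  rw [Finset.sum_eq_single (a j)]
  · simp [mul_comm]
  · intro b _ hb; simp [hb]
  · simp

lemma finrank_hom_comm (X : C) (c : ι) :
    Module.finrank ℂ (X ⟶ P.obj c) = Module.finrank ℂ (P.obj c ⟶ X) := by
  classical
  obtain ⟨n, l, a, h⟩ := P.exists_expansion X
  have h1 := h (homTrace (P.obj c)) (𝟙 X)
  have h2 := h (cohomTrace (P.obj c)) (𝟙 X)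
  simp_rw [homTrace_id, P.finrank_hom] at h1
  simp_rw [cohomTrace_id, P.finrank_hom] at h2
  have : (Module.finrank ℂ (X ⟶ P.obj c) : ℂ) = Module.finrank ℂ (P.obj c ⟶ X) := by
    rw [h1, h2]
    simp_rw [eq_comm]
  exact_mod_cast this

end SimpleReps

lemma finrank_eq_of_equiv {X Y Z W : C} (e : (X ⟶ Y) ≃ (Z ⟶ W))
    (hadd : ∀ f g, e (f + g) = e f + e g) (hsmul : ∀ (z : ℂ) f, e (z • f) = z • e f) :
    Module.finrank ℂ (X ⟶ Y) = Module.finrank ℂ (Z ⟶ W) :=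
  LinearEquiv.finrank_eq { e with map_add' := hadd, map_smul' := hsmul }

lemma finrank_tensorLeft (X Y Z : C) :
    Module.finrank ℂ (Yᘁ ⊗ X ⟶ Z) = Module.finrank ℂ (X ⟶ Y ⊗ Z) :=
  finrank_eq_of_equiv (tensorLeftHomEquiv X Y Yᘁ Z)
    (fun f g => by simp [tensorLeftHomEquiv, MonoidalPreadditive.whiskerLeft_add])
    (fun z f => by simp [tensorLeftHomEquiv, MonoidalLinear.whiskerLeft_smul])

lemma finrank_tensorRight (X Y Z : C) :
    Module.finrank ℂ (X ⊗ Y ⟶ Z) = Module.finrank ℂ (X ⟶ Z ⊗ Yᘁ) :=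
  finrank_eq_of_equiv (tensorRightHomEquiv X Y Yᘁ Z)
    (fun f g => by simp [tensorRightHomEquiv, MonoidalPreadditive.add_whiskerRight])
    (fun z f => by simp [tensorRightHomEquiv, MonoidalLinear.smul_whiskerRight])

lemma finrank_congr {X Y X' Y' : C} (e : X ≅ X') (e' : Y ≅ Y') :
    Module.finrank ℂ (X ⟶ Y) = Module.finrank ℂ (X' ⟶ Y') :=
  finrank_eq_of_equiv (e.homCongr e') (fun f g => by simp) (fun z f => by simp)

instance instSimpleRightDual (X : C) [Simple X] : Simple Xᘁ := by
  apply simple_of_finrank_end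
  -- Rigidity: `End(X*) ≅ Hom(𝟙, X ⊗ X*) ≅ End(X)`.
  rw [finrank_congr (ρ_ Xᘁ).symm (Iso.refl Xᘁ), finrank_tensorLeft, ← finrank_tensorRight,
    finrank_congr (λ_ X) (Iso.refl X), finrank_endomorphism_simple_eq_one ℂ X]

end Semisimple

/-! ### Twists, fusion rules, Hopf links and characters of the fusion ring. -/

section Labels

open BraidedCategory

variable {C : Type u} [Category.{v} C] [Abelian C] [Linear ℂ C] [MonoidalCategory C]
  [MonoidalPreadditive C] [MonoidalLinear ℂ C] [BraidedCategory C] [RigidCategory C]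
  [PremodularCategory C]

lemma qTrace_smul {X : C} (z : ℂ) (f : X ⟶ X) : qTrace (z • f) = z * qTrace f :=
  ((qCyclicTrace C).toFun X).map_smul z f

lemma twist_simple (X : C) [Simple X] : (twist X).hom = scalar (twist X).hom • 𝟙 X :=
  eq_scalar_smul_id _

lemma scalar_twist_ne_zero (X : C) [Simple X] : scalar (twist X).hom ≠ 0 := by
  intro h
  have h' := twist_simple X
  rw [h, zero_smul] at h'
  refine id_nonzero X ?_
  rw [← (twist X).hom_inv_id, h', Limits.zero_comp]

lemma scalar_twist_of_iso {X Y : C} [Simple X] [Simple Y] (e : X ≅ Y) :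
    scalar (twist X).hom = scalar (twist Y).hom := by
  apply scalar_eq
  have h := twist_naturality e.hom
  rw [twist_simple Y] at h
  rw [← cancel_mono e.hom, ← h]
  simp

lemma rightAdjointMate_smul {X Y : C} (z : ℂ) (f : X ⟶ Y) :
    rightAdjointMate (z • f) = z • rightAdjointMate f := by
  simp [rightAdjointMate, MonoidalLinear.whiskerLeft_smul, MonoidalLinear.smul_whiskerRight]

lemma scalar_twist_rightDual (X : C) [Simple X] :
    scalar (twist Xᘁ).hom = scalar (twist X).hom := by
  apply scalar_eq
  rw [twist_rightDual, twist_simple X, rightAdjointMate_smul, rightAdjointMate_id]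
  rw [← twist_simple X]

/-- On the fusion space `Hom(Z, X ⊗ Y)` of simple objects the monodromy is a scalar. -/
lemma comp_monodromy {X Y Z : C} [Simple X] [Simple Y] [Simple Z] (f : Z ⟶ X ⊗ Y) :
    f ≫ monodromy X Y = (scalar (twist Z).hom /
      (scalar (twist X).hom * scalar (twist Y).hom)) • f := by
  have h := twist_naturality f
  rw [twist_tensor_hom, twist_simple X, twist_simple Y, twist_simple Z,
    MonoidalCategory.tensorHom_def, MonoidalLinear.smul_whiskerRight,
    MonoidalLinear.whiskerLeft_smul] at h
  simp only [id_whiskerRight, whiskerLeft_id, Linear.smul_comp, Linear.comp_smul,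
    Category.id_comp, smul_smul] at h
  have hX := scalar_twist_ne_zero X
  have hY := scalar_twist_ne_zero Y
  rw [mul_comm (scalar (twist X).hom), div_eq_inv_mul, mul_smul, ← h, smul_smul,
    inv_mul_cancel₀ (mul_ne_zero hY hX), one_smul]

lemma qTrace_monodromy_congr (X : C) {Y Z : C} (e : Y ≅ Z) :
    qTrace (monodromy X Y) = qTrace (monodromy X Z) := by
  have h := qTrace_comm (X ◁ e.hom) (X ◁ e.inv ≫ monodromy X Y)
  rw [← Category.assoc, ← whiskerLeft_comp, e.hom_inv_id, whiskerLeft_id, Category.id_comp,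
    Category.assoc, monodromy_naturality_right, ← Category.assoc, ← whiskerLeft_comp,
    e.inv_hom_id, whiskerLeft_id, Category.id_comp] at h
  exact h

lemma qTrace_monodromy_comm (X Y : C) : qTrace (monodromy X Y) = qTrace (monodromy Y X) :=
  qTrace_comm _ _

/-- For simple `X` the inner partial trace is a scalar and factors out. This is why encircling
yields characters of the fusion ring. -/
lemma ringTrace_tensor (X : C) [Simple X] (Y Z : C) :
    (ringTrace X).toFun (Y ⊗ Z) (𝟙 _) =
      (ringTrace X).toFun Y (𝟙 _) * (ringTrace X).toFun Z (𝟙 _) := by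
  simp only [ringTrace_apply, whiskerLeft_id, Category.comp_id]
  rw [ptr_monodromy_tensor, eq_scalar_smul_id (ptr (monodromy X Z)),
    MonoidalLinear.whiskerLeft_smul, whiskerLeft_id, Linear.smul_comp, Linear.comp_smul,
    Category.id_comp, ptr_smul, scalar_smul, ← eq_scalar_smul_id, mul_comm]
  rfl

lemma qTrace_eq_mul_scalar_ptr {X Y : C} [Simple X] (f : X ⊗ Y ⟶ X ⊗ Y) :
    qTrace f = qTrace (𝟙 X) * scalar (ptr f) := by
  rw [← qTrace_ptr, eq_scalar_smul_id (ptr f), qTrace_smul, ← eq_scalar_smul_id, mul_comm]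

/-- This only gives dimension `0` or `1` for the unit; `0` is excluded later by nondegeneracy. -/
lemma qTrace_unit_mul_self : qTrace (𝟙 (𝟙_ C)) * qTrace (𝟙 (𝟙_ C)) = qTrace (𝟙 (𝟙_ C)) := by
  have h1 : qTrace (𝟙 (𝟙_ C)) = scalar (ptr (𝟙 (𝟙_ C ⊗ 𝟙_ C))) := by
    rw [qTrace_eq_scalar_ptr, Category.id_comp, Iso.hom_inv_id]
  have h2 := qTrace_eq_mul_scalar_ptr (𝟙 (𝟙_ C ⊗ 𝟙_ C))
  rw [← h1] at h2
  rw [← h2]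
  exact (qCyclicTrace C).id_eq_of_iso (λ_ (𝟙_ C))

namespace SimpleReps

variable {ι : Type w} (P : SimpleReps C ι)

/-- The label of the dual of a simple object. -/
def dual (a : ι) : ι := (P.exists_iso (P.obj a)ᘁ inferInstance).choose

/-- The dual of a simple object is isomorphic to the representative of the dual label. -/
def dualIso (a : ι) : (P.obj a)ᘁ ≅ P.obj (P.dual a) :=
  (P.exists_iso (P.obj a)ᘁ inferInstance).choose_spec.some

lemma fusion_dual (a c e : ι) : P.fusion (P.dual a) c e = P.fusion a e c := by
  unfold fusion
  rw [finrank_congr (Iso.refl _) (whiskerRightIso (P.dualIso a).symm (P.obj c)),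
    ← finrank_hom_comm, finrank_tensorLeft]

open Classical in
lemma fusion_zero (a c : ι) : P.fusion a P.zero c = if c = a then 1 else 0 := by
  unfold fusion
  rw [finrank_congr (Iso.refl _) (whiskerLeftIso (P.obj a) P.zero_iso.some ≪≫ ρ_ _),
    finrank_hom]

/-- The unit occurs in `a* ⊗ b` exactly when `a = b`. -/
lemma dual_injective : Function.Injective P.dual := by
  classical
  intro a b h
  have h1 := P.fusion_dual a b P.zero
  rw [h, P.fusion_dual b b, fusion_zero, fusion_zero] at h1
  by_contra hab
  simp [Ne.symm hab] at h1

lemma θ_ne_zero (a : ι) : P.θ a ≠ 0 := scalar_twist_ne_zero _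

lemma θ_dual (a : ι) : P.θ (P.dual a) = P.θ a := by
  unfold θ
  rw [← scalar_twist_of_iso (P.dualIso a), scalar_twist_rightDual]

lemma d_dual (a : ι) : P.d (P.dual a) = P.d a :=
  ((qCyclicTrace C).id_eq_of_iso (P.dualIso a)).symm.trans (qTrace_rightDual _)

/-- The invariant of the Hopf link. -/
def hopf (a b : ι) : ℂ := qTrace (monodromy (P.obj a) (P.obj b))

/-- The character of the fusion ring attached to a label. -/
def char (a b : ι) : ℂ := (ringTrace (P.obj a)).toFun (P.obj b) (𝟙 _)

lemma sTilde_apply (a b : ι) : P.sTilde a b = P.hopf a (P.dual b) :=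
  qTrace_monodromy_congr _ (P.dualIso b)

lemma hopf_comm (a b : ι) : P.hopf a b = P.hopf b a := qTrace_monodromy_comm _ _

lemma hopf_eq (a b : ι) : P.hopf a b = P.d a * P.char a b := by
  unfold hopf char d
  rw [qTrace_eq_mul_scalar_ptr, ringTrace_apply, whiskerLeft_id, Category.comp_id]

variable [Fintype ι]

lemma char_mul (a b c : ι) :
    P.char a b * P.char a c = ∑ e, (P.fusion b c e : ℂ) * P.char a e := by
  unfold char
  rw [← ringTrace_tensor, P.cyclicTrace_eq_sum]
  refine Finset.sum_congr rfl fun e _ => ?_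
  rw [homTrace_id, mul_comm]
  rfl

/-- Encircling the closure of a self-braiding, in terms of the modular data. -/
lemma sum_trace_braidOp_mul_hopf (a x : ι) :
    ∑ c, LinearMap.trace ℂ _ (braidOp (P.obj a) (P.obj c)) * P.hopf x c =
      P.θ a * ∑ y, P.d y * (P.fusion x a y : ℂ) * (P.θ y / (P.θ x * P.θ a)) ^ 2 := by
  -- The ring trace is expanded over the simple summands of `a ⊗ a`; `h4` expands the same diagram,
  -- after pulling the ring through, over those of `x ⊗ a`.
  have h1 := P.cyclicTrace_eq_sum (ringTrace (P.obj x)) (β_ (P.obj a) (P.obj a)).hom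
  have h2 : (ringTrace (P.obj x)).toFun _ (β_ (P.obj a) (P.obj a)).hom =
      P.θ a * scalar (ptr (monodromy (P.obj x) (P.obj a) ≫ monodromy (P.obj x) (P.obj a))) := by
    rw [ringTrace_apply, ptr_monodromy_comp_braiding, twist_simple (P.obj a),
      MonoidalLinear.whiskerLeft_smul, whiskerLeft_id, Linear.smul_comp, Linear.comp_smul,
      Category.id_comp, ptr_smul, scalar_smul]
    rfl
  have h3 := qTrace_eq_mul_scalar_ptr
    (monodromy (P.obj x) (P.obj a) ≫ monodromy (P.obj x) (P.obj a))
  have h4 := P.cyclicTrace_eq_sum (qCyclicTrace C)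
    (monodromy (P.obj x) (P.obj a) ≫ monodromy (P.obj x) (P.obj a))
  have h5 : ∀ y, (homTrace (P.obj y)).toFun _
      (monodromy (P.obj x) (P.obj a) ≫ monodromy (P.obj x) (P.obj a)) =
        (P.fusion x a y : ℂ) * (P.θ y / (P.θ x * P.θ a)) ^ 2 := by
    intro y
    have : Linear.rightComp ℂ (P.obj y)
        (monodromy (P.obj x) (P.obj a) ≫ monodromy (P.obj x) (P.obj a)) =
        ((P.θ y / (P.θ x * P.θ a)) ^ 2) • LinearMap.id := by
      ext f
      simp only [Linear.rightComp_apply, LinearMap.smul_apply, LinearMap.id_apply]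
      rw [← Category.assoc, comp_monodromy, comp_monodromy, smul_smul, sq]
      rfl
    rw [homTrace_apply, this, map_smul, LinearMap.trace_id, smul_eq_mul, mul_comm]
    rfl
  simp_rw [h5] at h4
  rw [h2] at h1
  calc _ = P.d x * ∑ c, (ringTrace (P.obj x)).toFun (P.obj c) (𝟙 _) *
        (homTrace (P.obj c)).toFun _ (β_ (P.obj a) (P.obj a)).hom := by
        rw [Finset.mul_sum]
        refine Finset.sum_congr rfl fun c _ => ?_
        rw [hopf_eq, homTrace_apply]
        unfold char braidOp
        ring
    _ = P.θ a * (P.d x * scalar (ptr (monodromy (P.obj x) (P.obj a) ≫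
          monodromy (P.obj x) (P.obj a)))) := by rw [← h1]; ring
    _ = _ := by
        rw [show P.d x * scalar (ptr (monodromy (P.obj x) (P.obj a) ≫
          monodromy (P.obj x) (P.obj a))) = _ from h3.symm, ← qCyclicTrace_apply, h4]
        congr 1
        refine Finset.sum_congr rfl fun y _ => ?_
        rw [mul_assoc]
        rfl

/-- Evaluate `∑_{c,e} χ_{a'}(c)^* N_{bc}^e χ_a(e)` twice: the sum over `e` extracts `χ_a(b)`, while
`N_{bc}^e = N_{b*e}^c` lets the sum over `c` extract `χ_{a'}(b*)^*`. -/
lemma char_sub_star_mul (a a' b : ι) :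
    (P.char a b - star (P.char a' (P.dual b))) * ∑ e, star (P.char a' e) * P.char a e = 0 := by
  have h1 : P.char a b * ∑ e, star (P.char a' e) * P.char a e =
      ∑ c, ∑ e, star (P.char a' c) * ((P.fusion b c e : ℂ) * P.char a e) := by
    rw [Finset.mul_sum]
    refine Finset.sum_congr rfl fun c _ => ?_
    rw [← Finset.mul_sum, ← char_mul]
    ring
  have h2 : star (P.char a' (P.dual b)) * ∑ e, star (P.char a' e) * P.char a e =
      ∑ e, ∑ c, star (P.char a' c) * ((P.fusion b c e : ℂ) * P.char a e) := by
    rw [Finset.mul_sum]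
    refine Finset.sum_congr rfl fun e _ => ?_
    rw [← mul_assoc, ← star_mul', char_mul, star_sum, Finset.sum_mul]
    refine Finset.sum_congr rfl fun c _ => ?_
    rw [fusion_dual, star_mul', star_natCast]
    ring
  rw [sub_mul, h1, h2, Finset.sum_comm, sub_self]

end SimpleReps

end Labels

/-! ### Unitarity of `S`, the Verlinde formula and the trace formula. -/

section Modular

variable {C : Type u} [Category.{v} C] [Abelian C] [Linear ℂ C] [MonoidalCategory C]
  [MonoidalPreadditive C] [MonoidalLinear ℂ C] [BraidedCategory C] [RigidCategory C]
  [ModularCategory C]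

namespace SimpleReps

variable {ι : Type w}

/-- Relabelling of a set of representatives of the simple objects. -/
def reindex {κ : Type*} (P : SimpleReps C ι) (e : κ ≃ ι) : SimpleReps C κ where
  obj k := P.obj (e k)
  simple k := P.simple _
  eq_of_iso a b h := e.injective (P.eq_of_iso _ _ h)
  exists_iso X hX := by
    obtain ⟨a, ⟨i⟩⟩ := P.exists_iso X hX
    exact ⟨e.symm a, ⟨i ≪≫ eqToIso (by simp)⟩⟩
  zero := e.symm P.zero
  zero_iso := by simpa using P.zero_iso

variable [Fintype ι] (P : SimpleReps C ι)

/-- The sole entry point of nondegeneracy, transported from `Fin n` to the label type. -/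
lemma eq_zero_of_sum_mul_sTilde (v : ι → ℂ) (h : ∀ b, ∑ a, v a * P.sTilde a b = 0) : v = 0 := by
  let e := (Fintype.equivFin ι).symm
  have hdet := ModularCategory.nondegenerate _ (P.reindex e)
  have h0 : Matrix.vecMul (v ∘ e) (P.reindex e).sTilde = 0 := by
    funext k
    exact (e.sum_comp fun a => v a * P.sTilde a (e k)).trans (h (e k))
  have h1 := Matrix.eq_zero_of_vecMul_eq_zero hdet.ne_zero h0
  funext a
  simpa using congrFun h1 (e.symm a)

lemma d_ne_zero (a : ι) : P.d a ≠ 0 := by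
  classical
  intro h
  have := P.eq_zero_of_sum_mul_sTilde (Pi.single a 1) fun b => by
    rw [Finset.sum_eq_single a (fun c _ hc => by simp [hc]) (by simp), sTilde_apply, hopf_eq, h]
    simp
  simpa using congrFun this a

lemma exists_char_ne_zero (a : ι) : ∃ b, P.char a b ≠ 0 := by
  classical
  by_contra! h
  have := P.eq_zero_of_sum_mul_sTilde (Pi.single a 1) fun b => by
    rw [Finset.sum_eq_single a (fun c _ hc => by simp [hc]) (by simp), sTilde_apply, hopf_eq, h]
    simp
  simpa using congrFun this a

lemma exists_char_ne {a c : ι} (hac : a ≠ c) : ∃ b, P.char a b ≠ P.char c b := by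
  classical
  by_contra! h
  -- Equal characters would make rows `a` and `c` proportional, in the ratio `d_a : d_c`.
  have := P.eq_zero_of_sum_mul_sTilde (Pi.single a (P.d c) - Pi.single c (P.d a)) fun b => by
    simp only [Pi.sub_apply, sub_mul, Finset.sum_sub_distrib]
    rw [Finset.sum_eq_single a (fun e _ he => by simp [he]) (by simp),
      Finset.sum_eq_single c (fun e _ he => by simp [he]) (by simp)]
    simp only [sTilde_apply, hopf_eq, h, Pi.single_eq_same]
    ring
  have h' := congrFun this a
  simp [hac] at h'
  exact P.d_ne_zero c h'

lemma char_zero (a : ι) : P.char a P.zero = 1 := by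
  classical
  obtain ⟨b, hb⟩ := P.exists_char_ne_zero a
  have h := P.char_mul a b P.zero
  simp only [fusion_zero, Nat.cast_ite, Nat.cast_one, Nat.cast_zero, ite_mul, one_mul, zero_mul,
    Finset.sum_ite_eq', Finset.mem_univ, if_true] at h
  exact mul_left_cancel₀ hb (by rw [h, mul_one])

lemma d_zero : P.d P.zero = 1 := by
  have h : P.d P.zero = qTrace (𝟙 (𝟙_ C)) := (qCyclicTrace C).id_eq_of_iso P.zero_iso.some
  have h1 : P.d P.zero * P.d P.zero = P.d P.zero := by rw [h]; exact qTrace_unit_mul_self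
  exact mul_left_cancel₀ (P.d_ne_zero _) (by rw [h1, mul_one])

lemma hopf_zero (a : ι) : P.hopf P.zero a = P.d a := by
  rw [hopf_comm, hopf_eq, char_zero, mul_one]

lemma zero_char (a : ι) : P.char P.zero a = P.d a := by
  rw [← hopf_zero, hopf_eq, d_zero, one_mul]

/-- A sum of squared moduli that contains `|χ_a(0)|² = 1`. -/
lemma sum_star_char_mul_char_ne_zero (a : ι) :
    ∑ e, star (P.char a e) * P.char a e ≠ 0 := by
  have h : ∑ e, star (P.char a e) * P.char a e =
      ((∑ e, Complex.normSq (P.char a e) : ℝ) : ℂ) := by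
    rw [Complex.ofReal_sum]
    exact Finset.sum_congr rfl fun e _ => Complex.normSq_eq_conj_mul_self.symm
  rw [h, Complex.ofReal_ne_zero]
  refine (lt_of_lt_of_le zero_lt_one ?_).ne'
  have := Finset.single_le_sum (f := fun e => Complex.normSq (P.char a e))
    (fun e _ => Complex.normSq_nonneg _) (Finset.mem_univ P.zero)
  simpa [char_zero] using this

lemma star_char_dual (a b : ι) : star (P.char a (P.dual b)) = P.char a b :=
  ((sub_eq_zero.mp ((mul_eq_zero.mp (P.char_sub_star_mul a a b)).resolve_right
    (P.sum_star_char_mul_char_ne_zero a)))).symm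

lemma sum_star_char_mul_char {a c : ι} (hac : a ≠ c) :
    ∑ e, star (P.char c e) * P.char a e = 0 := by
  obtain ⟨b, hb⟩ := P.exists_char_ne hac
  have h := P.char_sub_star_mul a c b
  rw [star_char_dual] at h
  exact (mul_eq_zero.mp h).resolve_left (sub_ne_zero.mpr hb)

lemma star_d (a : ι) : star (P.d a) = P.d a := by
  rw [← d_dual, ← zero_char, star_char_dual, zero_char, zero_char, d_dual]

lemma star_hopf (a b : ι) : star (P.hopf a b) = P.hopf a (P.dual b) := by
  rw [hopf_eq, hopf_eq, star_mul', star_d, ← P.star_char_dual a b, star_star]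

lemma star_hopf_dual (a b : ι) : star (P.hopf a (P.dual b)) = P.hopf a b := by
  rw [← star_hopf, star_star]

/-- The real part in the definition of `D` loses nothing, since all `d_a` are real. -/
lemma D_sq : (P.D : ℂ) ^ 2 = ∑ a, P.d a ^ 2 := by
  have h : ∀ a, P.d a ^ 2 = (((P.d a).re ^ 2 : ℝ) : ℂ) := fun a => by
    have : ((P.d a).re : ℂ) = P.d a := Complex.conj_eq_iff_re.mp (P.star_d a)
    rw [Complex.ofReal_pow, this]
  have h2 : ∑ a, P.d a ^ 2 = ((∑ a, (P.d a).re ^ 2 : ℝ) : ℂ) := by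
    rw [Complex.ofReal_sum]
    exact Finset.sum_congr rfl fun a _ => h a
  unfold D
  rw [h2, Complex.ofReal_re, ← Complex.ofReal_pow,
    Real.sq_sqrt (Finset.sum_nonneg fun a _ => sq_nonneg _)]

lemma sum_star_hopf_mul_hopf_of_ne {a c : ι} (hac : a ≠ c) :
    ∑ b, star (P.hopf c b) * P.hopf a b = 0 := by
  have : ∑ b, star (P.hopf c b) * P.hopf a b =
      star (P.d c) * P.d a * ∑ b, star (P.char c b) * P.char a b := by
    rw [Finset.mul_sum]
    refine Finset.sum_congr rfl fun b _ => ?_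
    rw [hopf_eq, hopf_eq, star_mul']
    ring
  rw [this, P.sum_star_char_mul_char hac, mul_zero]

lemma sum_star_hopf_mul_hopf_self (a : ι) :
    ∑ b, star (P.hopf a b) * P.hopf a b = (P.D : ℂ) ^ 2 := by
  have h0 : ∑ b, star (P.hopf P.zero b) * P.hopf P.zero b = (P.D : ℂ) ^ 2 := by
    rw [D_sq]
    refine Finset.sum_congr rfl fun b _ => ?_
    rw [hopf_zero, star_d, sq]
  -- All diagonal entries of `H H*` agree: associating `H H̄ H` in two ways and reading entry `(a,
  -- 0)` gives the `a`-th one times `d_a`, and `D² d_a`.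
  have hl : ∑ c, ∑ b, P.hopf a b * star (P.hopf b c) * P.hopf c P.zero =
      (∑ b, star (P.hopf a b) * P.hopf a b) * P.d a := by
    rw [Finset.sum_eq_single a]
    · rw [← hopf_zero, P.hopf_comm P.zero, Finset.sum_mul]
      refine Finset.sum_congr rfl fun b _ => ?_
      rw [P.hopf_comm b a]; ring
    · intro c _ hc
      rw [← Finset.sum_mul, ← zero_mul (P.hopf c P.zero), ← P.sum_star_hopf_mul_hopf_of_ne hc.symm]
      congr 1
      refine Finset.sum_congr rfl fun b _ => ?_
      rw [P.hopf_comm b c]; ring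
    · simp
  have hr : ∑ b, ∑ c, P.hopf a b * star (P.hopf b c) * P.hopf c P.zero =
      (P.D : ℂ) ^ 2 * P.d a := by
    rw [Finset.sum_eq_single P.zero]
    · rw [← h0, Finset.sum_mul]
      refine Finset.sum_congr rfl fun c _ => ?_
      rw [P.hopf_comm c, P.hopf_comm a, P.hopf_zero a]; ring
    · intro b _ hb
      rw [← mul_zero (P.hopf a b), ← P.sum_star_hopf_mul_hopf_of_ne hb.symm, Finset.mul_sum]
      refine Finset.sum_congr rfl fun c _ => ?_
      rw [P.hopf_comm c]; ring
    · simp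
  rw [Finset.sum_comm, hl] at hr
  exact mul_right_cancel₀ (P.d_ne_zero a) hr

open Classical in
lemma sum_star_hopf_mul_hopf (a c : ι) :
    ∑ b, star (P.hopf c b) * P.hopf a b = if a = c then (P.D : ℂ) ^ 2 else 0 := by
  split_ifs with h
  · subst h; exact P.sum_star_hopf_mul_hopf_self a
  · exact P.sum_star_hopf_mul_hopf_of_ne h

lemma D_ne_zero : (P.D : ℂ) ≠ 0 := by
  intro h
  have h1 := P.sum_star_hopf_mul_hopf_self P.zero
  have h2 := P.sum_star_char_mul_char_ne_zero P.zero
  simp only [hopf_eq, d_zero, one_mul] at h1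
  rw [h1, h] at h2
  simp at h2

/-- The dual on the second label of `sTilde` amounts to complex conjugation of the Hopf invariant.
-/
lemma S_apply (a b : ι) : P.S a b = (P.D : ℂ)⁻¹ * star (P.hopf a b) := by
  rw [star_hopf, ← sTilde_apply]
  rfl

lemma star_S_apply (a b : ι) : star (P.S a b) = (P.D : ℂ)⁻¹ * P.hopf a b := by
  rw [S_apply, star_mul', star_star, star_inv₀]
  congr 2
  exact Complex.conj_ofReal _

lemma S_zero_apply (a : ι) : P.S P.zero a = (P.D : ℂ)⁻¹ * P.d a := by
  rw [S_apply, hopf_zero, star_d]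

/-- The Verlinde formula. -/
lemma sum_S_div (a x y : ι) :
    ∑ z, P.S a z * star (P.S x z) * star (P.S y z) / P.S P.zero z = P.fusion x y a := by
  classical
  have hD := P.D_ne_zero
  -- Each `H_{zx}/d_z` is a character value, so the product of two of them expands by fusion;
  -- orthogonality in `z` then keeps only `e = a`.
  have h : ∀ z, P.S a z * star (P.S x z) * star (P.S y z) / P.S P.zero z =
      ((P.D : ℂ) ^ 2)⁻¹ * ∑ e, (P.fusion x y e : ℂ) * (star (P.hopf a z) * P.hopf e z) := by
    intro z
    have hz := P.d_ne_zero z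
    have h1 : ∑ e, (P.fusion x y e : ℂ) * (star (P.hopf a z) * P.hopf e z) =
        star (P.hopf a z) * P.d z * (P.char z x * P.char z y) := by
      rw [char_mul, Finset.mul_sum]
      refine Finset.sum_congr rfl fun e _ => ?_
      rw [P.hopf_comm e, P.hopf_eq z]; ring
    rw [h1, S_zero_apply, star_S_apply, star_S_apply, S_apply, P.hopf_comm x, P.hopf_comm y,
      P.hopf_eq z, P.hopf_eq z]
    field_simp
  simp_rw [h]
  rw [← Finset.mul_sum, Finset.sum_comm]
  simp_rw [← Finset.mul_sum, sum_star_hopf_mul_hopf]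
  simp only [mul_ite, mul_zero, Finset.sum_ite_eq', Finset.mem_univ, if_true]
  field_simp

lemma modularDataSum_eq (a c : ι) : modularDataSum P.S P.θ P.zero a c =
    ((P.D : ℂ) ^ 2)⁻¹ * ∑ x, P.hopf x c * (P.θ a * ∑ y, P.d y * (P.fusion x y a : ℂ) *
      (P.θ y / (P.θ x * P.θ a)) ^ 2) := by
  unfold modularDataSum
  rw [Finset.mul_sum]
  refine Finset.sum_congr rfl fun x _ => ?_
  rw [Finset.mul_sum, Finset.mul_sum, Finset.mul_sum]
  refine Finset.sum_congr rfl fun y _ => ?_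
  have h := P.sum_S_div a x y
  have ha := P.θ_ne_zero a
  have hx := P.θ_ne_zero x
  have hD := P.D_ne_zero
  calc _ = (P.θ y ^ 2 / (P.θ a * P.θ x ^ 2) * P.S P.zero y * star (P.S c x)) *
        ∑ z, P.S a z * star (P.S x z) * star (P.S y z) / P.S P.zero z := by
        rw [Finset.mul_sum]
        refine Finset.sum_congr rfl fun z _ => ?_
        ring
    _ = _ := by
        rw [h, S_zero_apply, star_S_apply, P.hopf_comm c]
        field_simp

/-- The trace of the self-braiding on a fusion space, in terms of the modular data. -/
theorem trace_braidOp (a c : ι) : LinearMap.trace ℂ _ (braidOp (P.obj a) (P.obj c)) =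
    modularDataSum P.S P.θ P.zero a c := by
  classical
  have hD := P.D_ne_zero
  -- Orthogonality inverts the encircling identity.
  have h1 : ∑ x, star (P.hopf x c) * ∑ e, LinearMap.trace ℂ _ (braidOp (P.obj a) (P.obj e)) *
      P.hopf x e = LinearMap.trace ℂ _ (braidOp (P.obj a) (P.obj c)) * (P.D : ℂ) ^ 2 := by
    simp_rw [Finset.mul_sum]
    rw [Finset.sum_comm]
    have : ∀ e, ∑ x, star (P.hopf x c) * (LinearMap.trace ℂ _ (braidOp (P.obj a) (P.obj e)) *
        P.hopf x e) = LinearMap.trace ℂ _ (braidOp (P.obj a) (P.obj e)) *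
          if e = c then (P.D : ℂ) ^ 2 else 0 := by
      intro e
      rw [← sum_star_hopf_mul_hopf, Finset.mul_sum]
      refine Finset.sum_congr rfl fun x _ => ?_
      rw [P.hopf_comm x, P.hopf_comm x]; ring
    simp_rw [this]
    simp
  rw [modularDataSum_eq, eq_inv_mul_iff_mul_eq₀ (pow_ne_zero 2 hD), mul_comm, ← h1]
  simp_rw [sum_trace_braidOp_mul_hopf]
  -- Substituting `x*` for `x` removes the conjugation from `H`, turns `N_{x*a}^y` into `N_{xy}^a`
  -- and fixes `θ_x`.
  have hb : Function.Bijective P.dual := Finite.injective_iff_bijective.mp P.dual_injective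
  rw [← hb.sum_comp]
  refine Finset.sum_congr rfl fun x _ => ?_
  simp_rw [θ_dual, fusion_dual]
  rw [P.hopf_comm (P.dual x), star_hopf_dual, P.hopf_comm]

end SimpleReps

end Modular

/-! ### Traces of involutions. -/

section Involution

/-- The trace of an involution is its signature. -/
lemma trace_eq_signature_of_mul_self_eq_one {V : Type*} [AddCommGroup V] [Module ℂ V]
    [FiniteDimensional ℂ V] (T : Module.End ℂ V) (h : T * T = 1) :
    LinearMap.trace ℂ V T = (Module.finrank ℂ (Module.End.eigenspace T 1) : ℂ) -
      Module.finrank ℂ (Module.End.eigenspace T (-1)) := by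
  have hT : ∀ v, T (T v) = v := fun v => LinearMap.congr_fun h v
  -- The maps `(1 ± T)/2` project onto the two eigenspaces; their traces are the dimensions and
  -- their difference is `T`.
  have h1 : LinearMap.IsProj (Module.End.eigenspace T 1) ((2⁻¹ : ℂ) • (1 + T)) := by
    refine ⟨fun v => ?_, fun v hv => ?_⟩
    · rw [Module.End.mem_eigenspace_iff]
      simp [hT, add_comm]
    · rw [Module.End.mem_eigenspace_iff, one_smul] at hv
      simp only [LinearMap.smul_apply, LinearMap.add_apply, Module.End.one_apply, hv]
      rw [← two_smul ℂ v, smul_smul, inv_mul_cancel₀ two_ne_zero, one_smul]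
  have h2 : LinearMap.IsProj (Module.End.eigenspace T (-1)) ((2⁻¹ : ℂ) • (1 - T)) := by
    refine ⟨fun v => ?_, fun v hv => ?_⟩
    · rw [Module.End.mem_eigenspace_iff]
      simp [hT, ← smul_neg]
    · rw [Module.End.mem_eigenspace_iff, neg_one_smul] at hv
      simp only [LinearMap.smul_apply, LinearMap.sub_apply, Module.End.one_apply, hv]
      rw [sub_neg_eq_add, ← two_smul ℂ v, smul_smul, inv_mul_cancel₀ two_ne_zero, one_smul]
  rw [← h1.trace, ← h2.trace, ← map_sub]
  congr 1
  ext v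
  simp only [LinearMap.sub_apply, LinearMap.smul_apply, LinearMap.add_apply, Module.End.one_apply]
  module

end Involution

/-! ### Signatures of `R` matrices and the Frobenius–Schur indicator. -/

section Signature

variable {C : Type u} [Category.{v} C] [Abelian C] [Linear ℂ C] [MonoidalCategory C]
  [MonoidalPreadditive C] [MonoidalLinear ℂ C] [BraidedCategory C] [RigidCategory C]
  [PremodularCategory C]

/-- The transpose appears because the rows of `rMatrix` index the input vector. -/
lemma rMatrix_eq_toMatrix {X Z : C} {m : Type*} [Fintype m] [DecidableEq m]
    (b : Module.Basis m ℂ (Z ⟶ X ⊗ X)) :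
    rMatrix b b = (LinearMap.toMatrix b b (braidOp X Z)).transpose := by
  ext i j
  simp [rMatrix, braidOp, LinearMap.toMatrix_apply]

lemma sum_rMatrix {X Z : C} {m : Type*} [Fintype m] (b : Module.Basis m ℂ (Z ⟶ X ⊗ X)) :
    ∑ μ, rMatrix b b μ μ = LinearMap.trace ℂ _ (braidOp X Z) := by
  classical
  rw [LinearMap.trace_eq_matrix_trace ℂ b, ← Matrix.trace_transpose, ← rMatrix_eq_toMatrix]
  rfl

/-- Needed because the indicator lives on `Hom(𝟙, X ⊗ X)`, while `P.obj P.zero` is only isomorphic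
to `𝟙`. -/
lemma trace_braidOp_of_iso (X : C) {Z W : C} (e : Z ≅ W) :
    LinearMap.trace ℂ _ (braidOp X Z) = LinearMap.trace ℂ _ (braidOp X W) := by
  have h := LinearMap.trace_comp_comm' (Linear.leftComp ℂ (X ⊗ X) e.hom)
    (braidOp X W ∘ₗ Linear.leftComp ℂ (X ⊗ X) e.inv)
  have h1 : Linear.leftComp ℂ (X ⊗ X) e.hom ∘ₗ braidOp X W ∘ₗ Linear.leftComp ℂ (X ⊗ X) e.inv =
      braidOp X Z := by ext; simp [braidOp]
  have h2 : (braidOp X W ∘ₗ Linear.leftComp ℂ (X ⊗ X) e.inv) ∘ₗ Linear.leftComp ℂ (X ⊗ X) e.hom =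
      braidOp X W := by ext; simp [braidOp]
  rw [h1, h2] at h
  exact h.symm

lemma rotation_eq (X : C) [Simple X] :
    rotation X = scalar (twist X).hom • braidOp X (𝟙_ C) := by
  ext f
  rw [rotation_apply, LinearMap.smul_apply, twist_simple X, MonoidalLinear.whiskerLeft_smul,
    whiskerLeft_id, Linear.smul_comp, Linear.comp_smul, Category.id_comp, ← twist_simple]
  rfl

namespace SimpleReps

variable {ι : Type w} (P : SimpleReps C ι)

lemma sqrt_ne_zero {t : ℂ} {c : ι} (ht : t ^ 2 = P.θ c) : t ≠ 0 := by
  rintro rfl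
  exact P.θ_ne_zero c (by rw [← ht]; simp)

lemma smul_braidOp_mul_self (a c : ι) (t : ℂ) (ht : t ^ 2 = P.θ c) :
    ((P.θ a / t) • braidOp (P.obj a) (P.obj c)) * ((P.θ a / t) • braidOp (P.obj a) (P.obj c)) =
      1 := by
  have h0 := P.sqrt_ne_zero ht
  have ha := P.θ_ne_zero a
  ext f
  have h := comp_monodromy f
  simp only [monodromy] at h
  simp only [Module.End.mul_apply, LinearMap.smul_apply, map_smul, braidOp,
    Linear.rightComp_apply, Module.End.one_apply, Category.assoc, h, smul_smul]
  change (P.θ a / t * (P.θ a / t * (P.θ c / (P.θ a * P.θ a)))) • f = f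
  rw [← ht, show P.θ a / t * (P.θ a / t * (t ^ 2 / (P.θ a * P.θ a))) = 1 by field_simp, one_smul]

lemma smul_rMatrix_mul_self (a c : ι) (t : ℂ) (ht : t ^ 2 = P.θ c) {m : Type*} [Fintype m]
    [DecidableEq m] (b : Module.Basis m ℂ (P.obj c ⟶ P.obj a ⊗ P.obj a)) :
    ((P.θ a / t) • rMatrix b b) * ((P.θ a / t) • rMatrix b b) = 1 := by
  have h := congrArg (LinearMap.toMatrix b b) (P.smul_braidOp_mul_self a c t ht)
  rw [LinearMap.toMatrix_mul, map_smul, LinearMap.toMatrix_one] at h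
  rw [rMatrix_eq_toMatrix, ← Matrix.transpose_smul, ← Matrix.transpose_mul, h,
    Matrix.transpose_one]

lemma trace_braidOp_eq_signature (a c : ι) (t : ℂ) (ht : t ^ 2 = P.θ c) :
    LinearMap.trace ℂ _ (braidOp (P.obj a) (P.obj c)) = t / P.θ a * (P.signature t a c : ℂ) := by
  have h0 := P.sqrt_ne_zero ht
  have ha := P.θ_ne_zero a
  have h := trace_eq_signature_of_mul_self_eq_one _ (P.smul_braidOp_mul_self a c t ht)
  rw [map_smul, smul_eq_mul] at h
  unfold signature
  push_cast
  rw [← h]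
  field_simp

lemma frobeniusSchur_eq (a : ι) (t : ℂ) (ht : t ^ 2 = P.θ P.zero) :
    frobeniusSchur (P.obj a) = t * (P.signature t a P.zero : ℂ) := by
  have ha := P.θ_ne_zero a
  unfold frobeniusSchur
  rw [rotation_eq, map_smul, smul_eq_mul, ← trace_braidOp_of_iso _ P.zero_iso.some,
    P.trace_braidOp_eq_signature a P.zero t ht]
  change P.θ a * _ = _
  field_simp

lemma signature_of_finrank_eq_one (a c : ι) (t : ℂ) (ht : t ^ 2 = P.θ c)
    (h1 : P.fusion a a c = 1) : P.signature t a c = 1 ∨ P.signature t a c = -1 := by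
  have h0 := P.sqrt_ne_zero ht
  have ha := P.θ_ne_zero a
  have b : Module.Basis (Fin 1) ℂ (P.obj c ⟶ P.obj a ⊗ P.obj a) :=
    Module.finBasisOfFinrankEq ℂ _ h1
  have hs := P.trace_braidOp_eq_signature a c t ht
  rw [← sum_rMatrix b, Fin.sum_univ_one] at hs
  -- The matrix is `1 × 1` with entry `(t/θ_a) Λ`, so the involution property reads `Λ² = 1`.
  have hm := congrFun (congrFun (P.smul_rMatrix_mul_self a c t ht b) 0) 0
  simp only [Matrix.mul_apply, Matrix.smul_apply, Fin.sum_univ_one, hs, smul_eq_mul,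
    Matrix.one_apply_eq] at hm
  have hm' : (P.signature t a c : ℂ) * P.signature t a c = 1 := by
    rw [← hm]; field_simp
  exact mul_self_eq_one_iff.mp (by exact_mod_cast hm')

end SimpleReps

end Signature

/-! ### Invariance under relabelling, and the theorem. -/

lemma modularDataSum_congr {ι : Type*} {ι' : Type*} [Fintype ι] [Fintype ι'] (σ : ι ≃ ι')
    {S : Matrix ι ι ℂ} {S' : Matrix ι' ι' ℂ} {θ : ι → ℂ} {θ' : ι' → ℂ}
    (hS : ∀ a b, S' (σ a) (σ b) = S a b) (hθ : ∀ a, θ' (σ a) = θ a) (o a c : ι) :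
    modularDataSum S' θ' (σ o) (σ a) (σ c) = modularDataSum S θ o a c := by
  unfold modularDataSum
  rw [← σ.sum_comp]
  refine Finset.sum_congr rfl fun x _ => ?_
  rw [← σ.sum_comp]
  refine Finset.sum_congr rfl fun y _ => ?_
  rw [← σ.sum_comp]
  refine Finset.sum_congr rfl fun z _ => ?_
  simp only [hS, hθ]

end ModCat

end
theorem mainTheorem6
    {C : Type*} [Category C] [Abelian C] [Linear ℂ C] [MonoidalCategory C]
    [MonoidalPreadditive C] [MonoidalLinear ℂ C] [BraidedCategory C] [RigidCategory C]
    [ModCat.ModularCategory C]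
    {ι : Type*} [Fintype ι] (P : ModCat.SimpleReps C ι)
    {C' : Type*} [Category C'] [Abelian C'] [Linear ℂ C'] [MonoidalCategory C']
    [MonoidalPreadditive C'] [MonoidalLinear ℂ C'] [BraidedCategory C'] [RigidCategory C']
    [ModCat.ModularCategory C']
    {ι' : Type*} [Fintype ι'] (P' : ModCat.SimpleReps C' ι') :
    -- the formula for the sum of `R` symbols, in every basis of the fusion space
    (∀ (a c : ι) (m : Type) [Fintype m]
      (b : Module.Basis m ℂ (P.obj c ⟶ P.obj a ⊗ P.obj a)),
      ∑ μ, ModCat.rMatrix b b μ μ = ModCat.modularDataSum P.S P.θ P.zero a c) ∧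
    -- the sum of `R` symbols as a signature: `(θ_a / t) R^{aa}_c` is an involution
    (∀ (a c : ι) (t : ℂ), t ^ 2 = P.θ c →
      ∀ (m : Type) [Fintype m] [DecidableEq m]
        (b : Module.Basis m ℂ (P.obj c ⟶ P.obj a ⊗ P.obj a)),
        ((P.θ a / t) • ModCat.rMatrix b b) * ((P.θ a / t) • ModCat.rMatrix b b) = 1 ∧
        ∑ μ, ModCat.rMatrix b b μ μ = t / P.θ a * (P.signature t a c : ℂ)) ∧
    -- `t * Λ_{a,c}` is an expression in the modular data
    (∀ (a c : ι) (t : ℂ), t ^ 2 = P.θ c →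
      t * (P.signature t a c : ℂ) =
        P.θ a * ModCat.modularDataSum P.S P.θ P.zero a c) ∧
    -- modular categories with the same modular data have the same `t * Λ_{a,c}`, and the same
    -- `Λ_{a,c}` for the same square root
    (∀ σ : ι ≃ ι', σ P.zero = P'.zero → (∀ a b, P'.S (σ a) (σ b) = P.S a b) →
      (∀ a, P'.θ (σ a) = P.θ a) →
      ∀ (a c : ι) (t t' : ℂ), t ^ 2 = P.θ c → t' ^ 2 = P.θ c →
        t * (P.signature t a c : ℂ) = t' * (P'.signature t' (σ a) (σ c) : ℂ) ∧
        P.signature t a c = P'.signature t (σ a) (σ c)) ∧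
    -- the Frobenius-Schur indicator is the case `c = 0`
    (∀ (a : ι) (t : ℂ), t ^ 2 = P.θ P.zero →
      ModCat.frobeniusSchur (P.obj a) = t * (P.signature t a P.zero : ℂ)) ∧
    -- the multiplicity-free case
    ((∀ a b c : ι, P.fusion a b c ≤ 1) →
      ∀ a c : ι, P.fusion a a c ≠ 0 → ∀ t : ℂ, t ^ 2 = P.θ c →
        (P.signature t a c = 1 ∨ P.signature t a c = -1) ∧
        ∀ (m : Type) (b : Module.Basis m ℂ (P.obj c ⟶ P.obj a ⊗ P.obj a)) (μ : m),
          ModCat.rMatrix b b μ μ = ModCat.modularDataSum P.S P.θ P.zero a c ∧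
          ModCat.rMatrix b b μ μ = (P.signature t a c : ℂ) * (t / P.θ a)) := by

  classical
  have key : ∀ (a c : ι) (t : ℂ), t ^ 2 = P.θ c → t * (P.signature t a c : ℂ) =
      P.θ a * ModCat.modularDataSum P.S P.θ P.zero a c := by
    intro a c t ht
    have ha := P.θ_ne_zero a
    rw [← P.trace_braidOp, P.trace_braidOp_eq_signature a c t ht]
    field_simp
  have key' : ∀ (a c : ι') (t : ℂ), t ^ 2 = P'.θ c → t * (P'.signature t a c : ℂ) =
      P'.θ a * ModCat.modularDataSum P'.S P'.θ P'.zero a c := by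
    intro a c t ht
    have ha := P'.θ_ne_zero a
    rw [← P'.trace_braidOp, P'.trace_braidOp_eq_signature a c t ht]
    field_simp
  refine ⟨fun a c m _ b => ?_, fun a c t ht m _ _ b => ⟨?_, ?_⟩, key, ?_,
    P.frobeniusSchur_eq, ?_⟩
  · rw [ModCat.sum_rMatrix, P.trace_braidOp]
  · exact P.smul_rMatrix_mul_self a c t ht b
  · rw [ModCat.sum_rMatrix, P.trace_braidOp_eq_signature a c t ht]
  · intro σ h0 hS hθ a c t t' ht ht'
    -- The root `s` stays free: `s = t'` compares the products, and `s = t` allows cancelling to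
    -- compare the signatures.
    have hk : ∀ s : ℂ, s ^ 2 = P.θ c →
        t * (P.signature t a c : ℂ) = s * (P'.signature s (σ a) (σ c) : ℂ) := by
      intro s hs
      rw [key a c t ht, key' (σ a) (σ c) s (by rw [hs, hθ]), ← h0, hθ,
        ModCat.modularDataSum_congr σ hS hθ]
    exact ⟨hk t' ht', by exact_mod_cast mul_left_cancel₀ (P.sqrt_ne_zero ht) (hk t ht)⟩
  · intro hN a c hne t ht
    have h1 : P.fusion a a c = 1 := le_antisymm (hN a a c) (Nat.one_le_iff_ne_zero.mpr hne)
    refine ⟨P.signature_of_finrank_eq_one a c t ht h1, fun m b μ => ?_⟩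
    -- The basis has a single vector, so its diagonal entry is the whole trace.
    have := FiniteDimensional.fintypeBasisIndex b
    have hcard : Fintype.card m = 1 := (Module.finrank_eq_card_basis b).symm.trans h1
    have := (Fintype.card_le_one_iff_subsingleton.mp hcard.le)
    have hsum : ModCat.rMatrix b b μ μ = ∑ ν, ModCat.rMatrix b b ν ν :=
      (Fintype.sum_subsingleton (fun ν => ModCat.rMatrix b b ν ν) μ).symm
    rw [hsum, ModCat.sum_rMatrix]
    exact ⟨P.trace_braidOp a c, by rw [P.trace_braidOp_eq_signature a c t ht, mul_comm]⟩
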